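/- **Theorem.** Consider the minimum-cost degree-bounded matroid basis problem: a matroid $M$ on $V=\{1,\dots,n\}$ with rank function $r$, costs $c:V\to\mathbb R_{\ge 0}$, sets $S_1,\dots,S_m\subseteq V$ and positive integers $b_1,\dots,b_m$; one seeks a cheap basis $I$ of $M$ with $|I\cap S_j|\le b_j$ for all $j$. Let $q=\max_{i\in V}|\{j: i\in S_j\}|$ be the maximum number of sets $S_j$ containing any element. Let the base polytope be $P=\{x\in[0,1]^n:\ \sum_{i\in T}x_i\le r(T)\ (T\subseteq V),\ \sum_{i\in V}x_i=r(V)\}$; a feasible LP solution is an $x\in P$ with $\sum_{i\in S_j}x_i\le b_j$ for all $j$. For $x\in P$ let $A(x)=\{i:0<x_i<1\}$ be the set of alive variables (the other variables are called frozen), and for $0<\delta<1/2$ let $W_\delta(x)\subseteq\mathbb R^n$ be the span of the vectors $\mathbf 1_{T\cap A(x)}$ with $\sum_{i\in T}x_i=r(T)$ (tight rank constraints) and $\mathbf 1_{S_j\cap A(x)}$ with $\sum_{i\in A(x)\cap S_j}(1-x_i)\ge q/(1-2\delta)$ (protected degree constraints). There are an absolute constant $C>0$ and a randomized iterated rounding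 algorithm, which in each iteration replaces the current solution $x$ by a next one drawn from a finitely supported distribution depending only on the instance, $\delta$ and $x$, such that the following holds for every instance and every $0<\delta<1/2$. 1. (Iterated rounding with slack.) For every $x\in P$, $\dim W_\delta(x)\le(1-\delta)\,|A(x)|$, and every possible next solution $x'$ lies in $P$, has $x'_i=x_i$ for all frozen $i$, and satisfies $x'-x\perp W_\delta(x)$. 2. Started from any feasible LP solution $x$, the algorithm reaches a $0$-$1$ solution after an expected number of at most $Cn^4$ iterations. If $I$ is the random set that it outputs and $X=\mathbf 1_I\in\{0,1\}^n$, then: * with probability $1$, $I$ is a basis of $M$ and $|I\cap S_j|-b_j<q/(1-2\delta)$ for all $j$; * $\mathbb E[X_i]=x_i$ for all $i$; in particular $\mathbb E[\sum_{i\in I}c_i]=\sum_i c_ix_i$; * $X$ is $\beta$-concentrated with $\beta=C/\delta\ge 1$, i.e. for all $a\in\mathbb R^n$ and $t\ge0$, with $M_a=\max_i|a_i|$, $$\Pr\big[a\cdot X-\mathbb E[a\cdot X]\ge t\big]\le\exp\left(-\frac{t^2/\beta}{2\left(\sum_i a_i^2(x_i-x_i^2)+M_at/3\right)}\right),$$ where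 the right-hand side is read as $1$ if the denominator is $0$. -/

import Mathlib

open Filter Topology

noncomputable section

/-- An instance of the minimum-cost degree-bounded matroid basis problem on the ground set
`{0, …, n-1}` with `m` degree constraints `|I ∩ S j| ≤ b j`. -/
structure DegMat (n m : ℕ) where
  M : Matroid (Fin n)
  ground_eq : M.E = Set.univ
  cost : Fin n → ℝ
  cost_nonneg : ∀ i, 0 ≤ cost i
  S : Fin m → Finset (Fin n)
  b : Fin m → ℕ
  b_pos : ∀ j, 0 < b j

/-- The 0-1 indicator vector of a set of elements. -/
def indVec {n : ℕ} (T : Finset (Fin n)) : Fin n → ℝ := fun i => if i ∈ T then 1 else 0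

/-- The alive (strictly fractional) variables of `x`. -/
def alive {n : ℕ} (x : Fin n → ℝ) : Finset (Fin n) :=
  Finset.univ.filter fun i => 0 < x i ∧ x i < 1

/-- All variables are `0` or `1`. -/
def IsIntegral01 {n : ℕ} (x : Fin n → ℝ) : Prop := ∀ i, x i = 0 ∨ x i = 1

namespace DegMat

variable {n m : ℕ} (D : DegMat n m)

/-- The rank function of the matroid, as a natural number (the ground set is finite). -/
def rank (T : Finset (Fin n)) : ℕ := (D.M.eRk (T : Set (Fin n))).toNat

/-- The maximum number of degree sets containing any one element. -/
def q : ℕ := Finset.univ.sup fun i : Fin n => (Finset.univ.filter fun j : Fin m => i ∈ D.S j).card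

/-- The matroid part of the linear program: box, rank and base constraints. -/
def InBasePolytope (x : Fin n → ℝ) : Prop :=
  (∀ i, 0 ≤ x i ∧ x i ≤ 1) ∧
  (∀ T : Finset (Fin n), ∑ i ∈ T, x i ≤ (D.rank T : ℝ)) ∧
  ∑ i, x i = (D.rank Finset.univ : ℝ)

/-- Feasible solutions of the linear program. -/
def Feasible (x : Fin n → ℝ) : Prop :=
  D.InBasePolytope x ∧ ∀ j, ∑ i ∈ D.S j, x i ≤ (D.b j : ℝ)

/-- The excess of degree constraint `j`: the largest possible increase of `∑ i ∈ S j, x i`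
when the alive variables are rounded. -/
def excess (x : Fin n → ℝ) (j : Fin m) : ℝ := ∑ i ∈ alive x ∩ D.S j, (1 - x i)

/-- The allowed degree violation for slack `δ`. -/
def threshold (δ : ℝ) : ℝ := (D.q : ℝ) / (1 - 2 * δ)

/-- The subspace of constraints kept at the current solution `x`, restricted to the alive
coordinates: all tight rank constraints, and the protected degree constraints, those with excess
at least `q / (1 - 2δ)`. For `x` in the base polytope the sets `T ∩ alive x` with `T` tight
are exactly the tight sets of the minor obtained by deleting the elements with `x i = 0` and
contracting those with `x i = 1`; their constraints span the same space as those of a maximal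
chain of tight sets. -/
def constraintSpace (δ : ℝ) (x : Fin n → ℝ) : Submodule ℝ (Fin n → ℝ) :=
  Submodule.span ℝ
    ({w | ∃ T : Finset (Fin n), ∑ i ∈ T, x i = (D.rank T : ℝ) ∧ w = indVec (T ∩ alive x)} ∪
     {w | ∃ j : Fin m, D.threshold δ ≤ D.excess x j ∧ w = indVec (D.S j ∩ alive x)})

end DegMat

/-- A randomized rounding algorithm: from the instance, the slack parameter and the current
solution it draws, with fresh randomness, the next solution. -/
def RoundingAlgorithm : Type :=
  ∀ n m : ℕ, DegMat n m → ℝ → (Fin n → ℝ) → PMF (Fin n → ℝ)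

namespace RoundingAlgorithm

variable (alg : RoundingAlgorithm) {n m : ℕ} (D : DegMat n m) (δ : ℝ) (x : Fin n → ℝ)

/-- `alg` is an iterated rounding algorithm with slack `δ` for every `0 < δ < 1/2`: at every
point `x` of the base polytope the constraint space has dimension at most `(1 - δ)` times the
number of alive variables, and the iteration makes a finite random choice of a next point of the
base polytope, leaves the frozen variables unchanged, and moves in the null space of the
constraint space. -/
def IsIteratedRounding : Prop :=
  ∀ (n m : ℕ) (D : DegMat n m) (δ : ℝ), 0 < δ → δ < 1 / 2 →
    ∀ x : Fin n → ℝ, D.InBasePolytope x →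
      (Module.finrank ℝ (D.constraintSpace δ x) : ℝ) ≤ (1 - δ) * ((alive x).card : ℝ) ∧
      (alg n m D δ x).support.Finite ∧
      ∀ x' ∈ (alg n m D δ x).support,
        D.InBasePolytope x' ∧
        (∀ i, i ∉ alive x → x' i = x i) ∧
        ∀ w ∈ D.constraintSpace δ x, ∑ i, w i * (x' i - x i) = 0

/-- The law of the solution at the beginning of iteration `k`, started from `x`. -/
def law : ℕ → PMF (Fin n → ℝ)
  | 0 => PMF.pure x
  | k + 1 => (law k).bind (alg n m D δ)

/-- The expected number of iterations until all variables are `0` or `1`, written as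
`∑ₖ Pr[the k-th solution is not yet integral]` (integral solutions are never changed again). -/
def expectedIterations : ENNReal :=
  ∑' k : ℕ, (alg.law D δ x k).toOuterMeasure {y | ¬ IsIntegral01 y}

/-- `μ` is the distribution of the final set of elements: the probability of `I` is the limit of
the probabilities that the `k`-th solution is the indicator vector of `I`. -/
def HasOutput (μ : PMF (Finset (Fin n))) : Prop :=
  ∀ I : Finset (Fin n), Tendsto (fun k => alg.law D δ x k (indVec I)) atTop (𝓝 (μ I))

end RoundingAlgorithm

/-- Expectation of a function of a random set. -/
def expect {n : ℕ} (μ : PMF (Finset (Fin n))) (f : Finset (Fin n) → ℝ) : ℝ :=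
  ∑ I, (μ I).toReal * f I

/-- Probability of an event about a random set. -/
def prob {n : ℕ} (μ : PMF (Finset (Fin n))) (A : Set (Finset (Fin n))) : ℝ :=
  (μ.toOuterMeasure A).toReal

/-- `β`-concentration of the 0-1 indicator vector `X` of a random set: for every `a`, the sum
`a · X` satisfies Bernstein's upper tail bound up to the factor `β` in the exponent, where
`x i` is the mean of `X i` and `⨆ i, |a i|` is the maximum of the `|a i|`. -/
def IsConcentrated {n : ℕ} (μ : PMF (Finset (Fin n))) (β : ℝ) : Prop :=
  1 ≤ β ∧ ∀ (a : Fin n → ℝ) (t : ℝ), 0 ≤ t →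
    let x : Fin n → ℝ := fun i => expect μ fun I => indVec I i
    let aX : Finset (Fin n) → ℝ := fun I => ∑ i, a i * indVec I i
    prob μ {I | t ≤ aX I - expect μ aX} ≤
      Real.exp (-((t ^ 2 / β) /
        (2 * (∑ i, a i ^ 2 * (x i - x i ^ 2) + (⨆ i, |a i|) * t / 3))))

end

noncomputable section

/-! The rounding is a small-step random walk inside the base polytope, with directions orthogonal to
the kept constraints. Write A for the alive set and s for the sum of x over A. Uncrossing partitions
A according to the tight sets, and each class has integral positive sum of x and of 1 - x. So tight
rank constraints span dimension at most min(s, |A| - s). Each alive element lies in at most q degree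
sets, so protected constraints add at most (1 - 2δ)(|A| - s), for a total of at most (1 - δ)|A|
(`finrank_constraintSpace_le`).

Hence a subspace of relative dimension at least δ is free. By convex duality (`exists_subisotropic`)
it carries a distribution on unit vectors whose covariance U satisfies δU ≤ diag U. Moving along
such a direction, forward or backward with balanced probabilities, keeps the mean and this
inequality, and either moves a fixed length or makes a new constraint tight (`exists_random_step`).
Squared length plus rank of tight constraints then bounds the running time.

Sub-isotropy makes exp(λ a·x + (6λ²/δ) Σ aᵢ²(xᵢ - xᵢ²)) a supermartingale for small λ
(`sum_exp_step_le`). The quadratic term vanishes at 0-1 points, so the output has a Bernstein moment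
bound, and Markov's inequality gives concentration. For degrees, a protected sum does not move. Once
unprotected, even rounding up every alive element stays below the threshold
(`IsStep.degreeInvariant`). -/

/-- In a finite-dimensional space the convex hull of a compact set is compact. -/
theorem IsCompact.convexHull_of_finiteDimensional {E : Type*} [NormedAddCommGroup E]
    [NormedSpace ℝ E] [FiniteDimensional ℝ E] {s : Set E} (hs : IsCompact s) :
    IsCompact (convexHull ℝ s) := by
  let F : (k : ℕ) → (Fin k → ℝ) × (Fin k → E) → E := fun k p => ∑ i, p.1 i • p.2 i
  have hF : convexHull ℝ s = ⋃ k ∈ Finset.range (Module.finrank ℝ E + 2),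
      F k '' (stdSimplex ℝ (Fin k) ×ˢ Set.pi Set.univ fun _ => s) := by
    apply Set.Subset.antisymm
    · intro x hx
      obtain ⟨κ, _, z, w, hz, hi, hw, hw1, rfl⟩ := eq_pos_convex_span_of_mem_convexHull hx
      -- Carathéodory: at most dim + 1 points are needed, so the hull is a finite union of
      -- continuous images of simplex times a power of s.
      have hc : Fintype.card κ ≤ Module.finrank ℝ E + 1 :=
        hi.card_le_finrank_succ.trans (Nat.add_le_add_right (Submodule.finrank_le _) 1)
      let e := Fintype.equivFin κ
      refine Set.mem_biUnion (x := Fintype.card κ) (by simp; omega)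
        ⟨(w ∘ e.symm, z ∘ e.symm), ⟨⟨fun i => (hw _).le, ?_⟩, fun i _ => hz ⟨_, rfl⟩⟩, ?_⟩
      · simpa using (Equiv.sum_comp e.symm w).trans hw1
      · exact Equiv.sum_comp e.symm fun i => w i • z i
    · refine Set.iUnion₂_subset fun k _ => ?_
      rintro _ ⟨⟨w, z⟩, ⟨hw, hz⟩, rfl⟩
      exact (convex_convexHull ℝ s).sum_mem (fun i _ => hw.1 i) hw.2
        fun i _ => subset_convexHull ℝ s (hz i trivial)
  rw [hF]
  refine (Finset.finite_toSet _).isCompact_biUnion fun k _ => ?_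
  refine ((isCompact_stdSimplex ℝ (Fin k)).prod (isCompact_univ_pi fun _ => hs)).image ?_
  fun_prop

/-! ### Sub-isotropic distributions on a subspace, by duality. -/

section SubIsotropic

variable {ι : Type*} [Fintype ι]

/-- The quadratic form of a square array. -/
def quadForm (B : ι → ι → ℝ) (v : ι → ℝ) : ℝ := ∑ i, ∑ j, B i j * (v i * v j)

/-- A positive semidefinite form with diagonal at most `1` cannot be larger than `1 / δ` times the
squared norm on a subspace of dimension at least `δ` times the full dimension. -/
theorem exists_quadForm_le_of_finrank (B : ι → ι → ℝ) (hB : ∀ v, 0 ≤ quadForm B v)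
    (hd : ∀ i, B i i ≤ 1) (K : Submodule ℝ (EuclideanSpace ℝ ι)) {δ : ℝ} (hδ : 0 ≤ δ)
    (hK : δ * Fintype.card ι ≤ Module.finrank ℝ K) (hpos : 0 < Module.finrank ℝ K) :
    ∃ y ∈ K, ∑ i, y i ^ 2 = 1 ∧ δ * quadForm B y ≤ 1 := by
  -- If every unit vector of K failed, an orthonormal basis of K would give dim K < δ · trace B ≤ δ
  -- · card ι ≤ dim K, the trace being computed in an orthonormal basis extending that of K.
  classical
  by_contra! hcon
  let b := stdOrthonormalBasis ℝ K
  have hon : Orthonormal ℝ fun k => (b k : EuclideanSpace ℝ ι) :=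
    b.orthonormal.comp_linearIsometry K.subtypeₗᵢ
  obtain ⟨u, c, hvu, hc⟩ := hon.toSubtypeRange.exists_orthonormalBasis_extension
  have htr : ∑ e ∈ u, quadForm B e = ∑ i, B i i := by
    have h1 : ∀ i j, ∑ e ∈ u, e i * e j = if i = j then (1 : ℝ) else 0 := by
      intro i j
      have := c.sum_inner_mul_inner (EuclideanSpace.single i (1 : ℝ))
        (EuclideanSpace.single j (1 : ℝ))
      simp only [hc, EuclideanSpace.inner_single_left, EuclideanSpace.inner_single_right] at this
      rw [← Finset.sum_coe_sort u]
      simpa [Pi.single_apply, mul_comm, eq_comm] using this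
    simp only [quadForm]
    rw [Finset.sum_comm]
    refine Finset.sum_congr rfl fun i _ => ?_
    rw [Finset.sum_comm]
    simp_rw [← Finset.mul_sum, h1]
    simp
  have hsub : ∑ k, quadForm B (b k : EuclideanSpace ℝ ι) ≤ ∑ e ∈ u, quadForm B e := by
    have := Finset.sum_image (s := Finset.univ) (f := fun e : EuclideanSpace ℝ ι => quadForm B e)
      (g := fun k => (b k : EuclideanSpace ℝ ι)) (fun k _ l _ h => hon.linearIndependent.injective h)
    rw [← this]
    refine Finset.sum_le_sum_of_subset_of_nonneg ?_ fun e _ _ => hB e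
    intro e he
    obtain ⟨k, -, rfl⟩ := Finset.mem_image.1 he
    exact hvu ⟨k, rfl⟩
  have hlt : ∑ _k : Fin (Module.finrank ℝ K), (1 : ℝ)
      < ∑ k, δ * quadForm B (b k : EuclideanSpace ℝ ι) := by
    have : Nonempty (Fin (Module.finrank ℝ K)) := ⟨⟨0, hpos⟩⟩
    refine Finset.sum_lt_sum_of_nonempty Finset.univ_nonempty fun k _ => hcon _ (b k).2 ?_
    have := hon.1 k
    rw [EuclideanSpace.norm_eq, Real.sqrt_eq_one] at this
    simpa using this
  rw [← Finset.mul_sum] at hlt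
  have h3 : ∑ i, B i i ≤ Fintype.card ι := by
    simpa using Finset.sum_le_sum fun i (_ : i ∈ Finset.univ) => hd i
  have h4 : δ * ∑ k, quadForm B (b k : EuclideanSpace ℝ ι) ≤ δ * Fintype.card ι :=
    mul_le_mul_of_nonneg_left (hsub.trans (htr.le.trans h3)) hδ
  simp at hlt
  linarith

/-- A subspace of relative dimension at least `δ` carries a probability distribution on unit vectors
whose second moment matrix `U` satisfies `δ U ≤ diag U`. -/
theorem exists_subisotropic (L : Submodule ℝ (ι → ℝ)) {δ : ℝ} (hδ : 0 ≤ δ)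
    (hL : δ * Fintype.card ι ≤ Module.finrank ℝ L) (hpos : 0 < Module.finrank ℝ L) :
    ∃ (κ : Type) (_ : Fintype κ) (w : κ → ℝ) (u : κ → ι → ℝ),
      (∀ k, 0 ≤ w k) ∧ ∑ k, w k = 1 ∧ (∀ k, u k ∈ L) ∧ (∀ k, ∑ i, u k i ^ 2 = 1) ∧
      ∀ a : ι → ℝ, δ * ∑ k, w k * (∑ i, a i * u k i) ^ 2 ≤ ∑ k, w k * ∑ i, a i ^ 2 * u k i ^ 2 := by
  classical
  -- The goal says that some convex combination of the matrices diag(u²) - δuuᵀ, for unit u in L, is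
  -- positive semidefinite. Otherwise the compact hull is strictly separated from the closed cone P.
  let G : (ι → ℝ) → ι → ι → ℝ := fun u i j => (if i = j then u i ^ 2 else 0) - δ * (u i * u j)
  let s : Set (ι → ℝ) := {u | u ∈ L ∧ ∑ i, u i ^ 2 = 1}
  have hs : IsCompact s := by
    refine Metric.isCompact_of_isClosed_isBounded ?_ ?_
    · exact (Submodule.closed_of_finiteDimensional L).inter
        (isClosed_eq (by fun_prop) continuous_const)
    · refine (Metric.isBounded_closedBall (x := (0 : ι → ℝ)) (r := 1)).subset fun u hu => ?_
      rw [mem_closedBall_zero_iff, pi_norm_le_iff_of_nonneg zero_le_one]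
      intro i
      rw [Real.norm_eq_abs, ← sq_le_one_iff_abs_le_one, ← hu.2]
      exact Finset.single_le_sum (f := fun i => u i ^ 2) (fun i _ => sq_nonneg _)
        (Finset.mem_univ i)
  have hG : Continuous G := by
    refine continuous_pi fun i => continuous_pi fun j => ?_
    by_cases h : i = j <;> simp only [G, h, if_true, if_false] <;> fun_prop
  have hQ : ∀ (v u : ι → ℝ), quadForm (G u) v = ∑ i, v i ^ 2 * u i ^ 2 - δ * (∑ i, v i * u i) ^ 2 := by
    intro v u
    simp only [quadForm, G, sub_mul, Finset.sum_sub_distrib]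
    congr 1
    · simp only [ite_mul, zero_mul, Finset.sum_ite_eq, Finset.mem_univ, if_true]
      exact Finset.sum_congr rfl fun i _ => by ring
    · rw [sq, Finset.sum_mul_sum, Finset.mul_sum]
      refine Finset.sum_congr rfl fun i _ => ?_
      rw [Finset.mul_sum]
      exact Finset.sum_congr rfl fun j _ => by ring
  let P : Set (ι → ι → ℝ) := {A | ∀ v, 0 ≤ quadForm A v}
  by_cases hmeet : Disjoint (convexHull ℝ (G '' s)) P
  · exfalso
    have hPc : Convex ℝ P := by
      intro A hA B hB α β hα hβ _ v
      have : quadForm (α • A + β • B) v = α * quadForm A v + β * quadForm B v := by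
        simp only [quadForm, Finset.mul_sum, ← Finset.sum_add_distrib]
        refine Finset.sum_congr rfl fun i _ => Finset.sum_congr rfl fun j _ => ?_
        simp only [Pi.add_apply, Pi.smul_apply, smul_eq_mul]
        ring
      rw [this]
      exact add_nonneg (mul_nonneg hα (hA v)) (mul_nonneg hβ (hB v))
    have hPcl : IsClosed P := by
      have : P = ⋂ v, {A | 0 ≤ quadForm A v} := by ext; simp [P]
      rw [this]
      refine isClosed_iInter fun v => isClosed_le continuous_const ?_
      unfold quadForm
      fun_prop
    obtain ⟨f, r, t, hr, hrt, ht⟩ := geometric_hahn_banach_compact_closed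
      (convex_convexHull ℝ (G '' s)) (hs.image hG).convexHull_of_finiteDimensional hPc hPcl hmeet
    have ht0 : t < 0 := by
      have := ht 0 fun v => by simp [quadForm]
      simpa using this
    -- P is a cone: a negative value could be rescaled to be exactly t, which the strict separation
    -- forbids.
    have hfP : ∀ A ∈ P, 0 ≤ f A := by
      intro A hA
      by_contra! hneg
      have := ht ((t / f A) • A) fun v => by
        have h : quadForm ((t / f A) • A) v = (t / f A) * quadForm A v := by
          simp [quadForm, Finset.mul_sum, mul_assoc]
        rw [h]
        exact mul_nonneg (div_nonneg_of_nonpos ht0.le hneg.le) (hA v)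
      rw [map_smul, smul_eq_mul, div_mul_cancel₀ _ hneg.ne] at this
      exact lt_irrefl _ this
    let F : ι → ι → ℝ := fun i j => f (Pi.single i (Pi.single j 1))
    have hfF : ∀ A, f A = ∑ i, ∑ j, A i j * F i j := by
      intro A
      have : A = ∑ i, ∑ j, A i j • (Pi.single i (Pi.single j 1) : ι → ι → ℝ) := by
        ext i j
        simp [Finset.sum_apply, Pi.single_apply, apply_ite, ite_apply]
      conv_lhs => rw [this]
      simp [map_sum, F]
    have hFq : ∀ v, 0 ≤ quadForm F v := by
      intro v
      have h := hfP (fun i j => v i * v j) fun x => by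
        have : quadForm (fun i j => v i * v j) x = (∑ i, v i * x i) ^ 2 := by
          rw [sq, Finset.sum_mul_sum]
          exact Finset.sum_congr rfl fun i _ => Finset.sum_congr rfl fun j _ => by ring
        rw [this]; positivity
      rw [hfF] at h
      refine h.trans_eq ?_
      exact Finset.sum_congr rfl fun i _ => Finset.sum_congr rfl fun j _ => by ring
    have hFG : ∀ u ∈ s, ∑ i, F i i * u i ^ 2 - δ * quadForm F u < r := by
      intro u hu
      have := hr (G u) (subset_convexHull ℝ _ ⟨u, hu, rfl⟩)
      rw [hfF] at this
      refine this.trans_eq' ?_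
      simp only [G, sub_mul, Finset.sum_sub_distrib, ite_mul, zero_mul, Finset.sum_ite_eq,
        Finset.mem_univ, if_true, quadForm, Finset.mul_sum]
      congr 1
      · exact Finset.sum_congr rfl fun i _ => by ring
      · exact Finset.sum_congr rfl fun i _ => Finset.sum_congr rfl fun j _ => by ring
    have hr0 : r < 0 := hrt.trans ht0
    -- Subtracting r < 0 on the diagonal makes it strictly positive, so that F can be normalised to
    -- unit diagonal. The trace lemma on the rescaled L then yields u with F'(u) bounded by its own
    -- diagonal part over δ, contradicting `hFG`.
    let z : ι → ℝ := fun i => F i i - r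
    have hFd : ∀ i, 0 ≤ F i i := fun i => by
      have := hFq (Pi.single i 1)
      simpa [quadForm, Pi.single_apply] using this
    have hz : ∀ i, 0 < z i := fun i => by have := hFd i; simp only [z]; linarith
    let F' : ι → ι → ℝ := fun i j => F i j - if i = j then r else 0
    have hF' : ∀ v, quadForm F' v = quadForm F v - r * ∑ i, v i ^ 2 := by
      intro v
      simp only [F', quadForm, sub_mul, Finset.sum_sub_distrib, ite_mul, zero_mul,
        Finset.sum_ite_eq, Finset.mem_univ, if_true, Finset.mul_sum, sq]
    let B : ι → ι → ℝ := fun i j => F' i j / (√(z i) * √(z j))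
    have hB : ∀ v : ι → ℝ, quadForm B v = quadForm F' fun i => v i / √(z i) := by
      intro v
      refine Finset.sum_congr rfl fun i _ => Finset.sum_congr rfl fun j _ => ?_
      simp only [B]
      ring
    let Φ : (ι → ℝ) →ₗ[ℝ] EuclideanSpace ℝ ι :=
      { toFun := fun u => WithLp.toLp 2 fun i => √(z i) * u i
        map_add' := fun u v => by ext i; simp [mul_add]
        map_smul' := fun c v => by ext i; simp; ring }
    have hΦ : Function.Injective Φ := by
      intro u v h
      ext i
      have := congrArg (fun y : EuclideanSpace ℝ ι => y i) h
      simpa [Φ, (Real.sqrt_pos.2 (hz i)).ne'] using this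
    have hfr : Module.finrank ℝ (L.map Φ) = Module.finrank ℝ L :=
      (Submodule.equivMapOfInjective Φ hΦ L).finrank_eq.symm
    obtain ⟨y, ⟨u, huL, rfl⟩, hy1, hy2⟩ := exists_quadForm_le_of_finrank B
      (fun v => by
        rw [hB, hF']
        have := hFq fun i => v i / √(z i)
        have h2 : 0 ≤ ∑ i, (v i / √(z i)) ^ 2 := Finset.sum_nonneg fun i _ => sq_nonneg _
        nlinarith)
      (fun i => by
        simp only [B, F', if_true, Real.mul_self_sqrt (hz i).le]
        exact (div_self (hz i).ne').le)
      (L.map Φ) hδ (by rw [hfr]; exact hL) (by rw [hfr]; exact hpos)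
    have hΦu : ∀ i, (Φ u) i = √(z i) * u i := fun i => rfl
    have hq : quadForm B (Φ u) = quadForm F u - r * ∑ i, u i ^ 2 := by
      rw [hB, ← hF']
      congr 1
      ext i
      rw [hΦu, mul_div_cancel_left₀ _ (Real.sqrt_pos.2 (hz i)).ne']
    have hy1' : ∑ i, F i i * u i ^ 2 - r * ∑ i, u i ^ 2 = 1 := by
      rw [← hy1, Finset.mul_sum, ← Finset.sum_sub_distrib]
      refine Finset.sum_congr rfl fun i _ => ?_
      rw [hΦu, mul_pow, Real.sq_sqrt (hz i).le]
      simp only [z]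
      ring
    rw [hq] at hy2
    set S := ∑ i, u i ^ 2 with hS
    have hS0 : 0 < S := by
      rcases (Finset.sum_nonneg fun i (_ : i ∈ Finset.univ) => sq_nonneg (u i)).eq_or_lt with h | h
      · rw [eq_comm, Finset.sum_eq_zero_iff_of_nonneg fun i _ => sq_nonneg _] at h
        have hu0 : u = 0 := by
          ext i
          simpa using h i (Finset.mem_univ i)
        simp [hS, hu0] at hy1'
      · exact h
    have hus : (√S)⁻¹ • u ∈ s := by
      refine ⟨L.smul_mem _ huL, ?_⟩
      simp only [Pi.smul_apply, smul_eq_mul, mul_pow, ← Finset.mul_sum, inv_pow,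
        Real.sq_sqrt hS0.le]
      exact inv_mul_cancel₀ hS0.ne'
    have h5 := hFG _ hus
    have h6 : ∑ i, F i i * ((√S)⁻¹ • u) i ^ 2 - δ * quadForm F ((√S)⁻¹ • u)
        = (∑ i, F i i * u i ^ 2 - δ * quadForm F u) / S := by
      have h7 : ∀ c : ℝ, quadForm F (c • u) = c ^ 2 * quadForm F u := by
        intro c
        simp only [quadForm, Finset.mul_sum, Pi.smul_apply, smul_eq_mul]
        exact Finset.sum_congr rfl fun i _ => Finset.sum_congr rfl fun j _ => by ring
      rw [h7, inv_pow, Real.sq_sqrt hS0.le, sub_div, Finset.sum_div]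
      congr 1
      · refine Finset.sum_congr rfl fun i _ => ?_
        simp only [Pi.smul_apply, smul_eq_mul, mul_pow, inv_pow, Real.sq_sqrt hS0.le]
        ring
      · ring
    rw [h6, div_lt_iff₀ hS0] at h5
    linarith [mul_nonneg (mul_nonneg hδ hS0.le) (neg_nonneg.2 hr0.le)]
  · obtain ⟨A, hA, hAP⟩ := Set.not_disjoint_iff.1 hmeet
    obtain ⟨κ, _, w, g, hw, hw1, hg, rfl⟩ := mem_convexHull_iff_exists_fintype.1 hA
    choose u hu hug using hg
    refine ⟨κ, ‹_›, w, u, hw, hw1, fun k => (hu k).1, fun k => (hu k).2, fun a => ?_⟩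
    have h := hAP a
    have h2 : quadForm (∑ k, w k • g k) a = ∑ k, w k * quadForm (g k) a := by
      simp only [quadForm, Finset.mul_sum, Finset.sum_apply, Pi.smul_apply, smul_eq_mul,
        Finset.sum_mul]
      rw [Finset.sum_comm]
      conv_rhs => rw [Finset.sum_comm]
      rw [Finset.sum_comm]
      refine Finset.sum_congr rfl fun i _ => ?_
      rw [Finset.sum_comm]
      exact Finset.sum_congr rfl fun k _ => Finset.sum_congr rfl fun j _ => by ring
    rw [h2] at h
    simp_rw [← hug, hQ, mul_sub, Finset.sum_sub_distrib] at h
    rw [Finset.mul_sum]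
    have h3 : ∑ k, w k * (δ * (∑ i, a i * u k i) ^ 2) = ∑ k, δ * (w k * (∑ i, a i * u k i) ^ 2) :=
      Finset.sum_congr rfl fun k _ => by ring
    linarith

end SubIsotropic

/-! ### Random steps in a polyhedron and the exponential supermartingale. -/

section Polytope

variable {ι κ : Type*} [Fintype ι]

/-- The polyhedron of the inequalities `A c · x ≤ β c`. -/
def InPolyhedron (A : κ → ι → ℝ) (β : κ → ℝ) (x : ι → ℝ) : Prop := ∀ c, ∑ i, A c i * x i ≤ β c

/-- The span of the normals of the constraints that are tight at `x`. -/
def tightSpan (A : κ → ι → ℝ) (β : κ → ℝ) (x : ι → ℝ) : Submodule ℝ (ι → ℝ) :=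
  Submodule.span ℝ (A '' {c | ∑ i, A c i * x i = β c})

theorem sum_mul_add_smul (f x u : ι → ℝ) (s : ℝ) :
    ∑ i, f i * (x + s • u) i = ∑ i, f i * x i + s * ∑ i, f i * u i := by
  rw [Finset.mul_sum, ← Finset.sum_add_distrib]
  refine Finset.sum_congr rfl fun i _ => ?_
  simp only [Pi.add_apply, Pi.smul_apply, smul_eq_mul]
  ring

theorem tightSpan_le_add_smul {A : κ → ι → ℝ} {β : κ → ℝ} {x u : ι → ℝ}
    (hu : ∀ w ∈ tightSpan A β x, ∑ i, w i * u i = 0) (s : ℝ) :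
    tightSpan A β x ≤ tightSpan A β (x + s • u) := by
  refine Submodule.span_mono (Set.image_mono fun c hc => ?_)
  have := hu (A c) (Submodule.subset_span ⟨c, hc, rfl⟩)
  simp only [Set.mem_ofPred_eq] at hc ⊢
  rw [sum_mul_add_smul, this, hc]
  ring

/-- From a point of a polyhedron one can move by a step of size at most `γ` in a direction
orthogonal to the tight constraints; a step shorter than `γ` makes a new constraint tight. -/
theorem exists_step_size [Finite κ] {A : κ → ι → ℝ} {β : κ → ℝ} {x u : ι → ℝ}
    (hx : InPolyhedron A β x) (hu : ∀ w ∈ tightSpan A β x, ∑ i, w i * u i = 0)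
    {γ : ℝ} (hγ : 0 < γ) :
    ∃ s, 0 < s ∧ s ≤ γ ∧ InPolyhedron A β (x + s • u) ∧
      (s = γ ∨ Module.finrank ℝ (tightSpan A β x) <
        Module.finrank ℝ (tightSpan A β (x + s • u))) := by
  classical
  cases nonempty_fintype κ
  let d : κ → ℝ := fun c => ∑ i, A c i * u i
  let e : κ → ℝ := fun c => β c - ∑ i, A c i * x i
  have he : ∀ c, 0 ≤ e c := fun c => sub_nonneg.2 (hx c)
  have hed : ∀ c, 0 < d c → 0 < e c := by
    intro c hc
    refine (he c).lt_of_ne fun h => hc.ne' ?_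
    exact hu (A c) (Submodule.subset_span ⟨c, (sub_eq_zero.1 h.symm).symm, rfl⟩)
  -- Ratio test: either some constraint blocks before γ and the first one to do so becomes tight, or
  -- the full step fits. Its normal is outside the old span because it is not orthogonal to u.
  by_cases hF : ∃ c, 0 < d c ∧ e c / d c < γ
  · obtain ⟨c1, hc1, hc1γ⟩ := hF
    obtain ⟨c, hc, hmin⟩ := Finset.exists_min_image (Finset.univ.filter fun c => 0 < d c)
      (fun c => e c / d c) ⟨c1, by simpa using hc1⟩
    simp only [Finset.mem_filter, Finset.mem_univ, true_and] at hc hmin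
    refine ⟨e c / d c, div_pos (hed c hc) hc, (hmin c1 hc1).trans hc1γ.le, fun c' => ?_,
      Or.inr ?_⟩
    · rw [sum_mul_add_smul]
      have : e c / d c * d c' ≤ e c' := by
        rcases lt_or_ge 0 (d c') with h | h
        · have := hmin c' h
          rwa [le_div_iff₀ h] at this
        · exact (mul_nonpos_of_nonneg_of_nonpos (div_pos (hed c hc) hc).le h).trans (he c')
      have h2 : e c' = β c' - ∑ i, A c' i * x i := rfl
      have h3 : d c' = ∑ i, A c' i * u i := rfl
      rw [← h3]
      linarith
    · refine Submodule.finrank_lt_finrank_of_lt ((tightSpan_le_add_smul hu _).lt_of_ne fun h => ?_)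
      have hm : A c ∈ tightSpan A β (x + (e c / d c) • u) := by
        refine Submodule.subset_span ⟨c, ?_, rfl⟩
        simp only [Set.mem_ofPred_eq]
        rw [sum_mul_add_smul]
        change _ + e c / d c * d c = _
        rw [div_mul_cancel₀ _ hc.ne']
        simp only [e]
        ring
      rw [← h] at hm
      exact hc.ne' (hu _ hm)
  · push Not at hF
    refine ⟨γ, hγ, le_rfl, fun c => ?_, Or.inl rfl⟩
    rw [sum_mul_add_smul]
    change _ + γ * d c ≤ _
    have h2 : e c = β c - ∑ i, A c i * x i := rfl
    rcases lt_or_ge 0 (d c) with h | h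
    · have := hF c h
      rw [le_div_iff₀ h] at this
      linarith
    · have := mul_nonpos_of_nonneg_of_nonpos hγ.le h
      linarith [he c]

/-- A random walk step in a polyhedron: directions `u k` with weights `w k` can be turned into a
mean zero step that stays in the polyhedron, has the same second moments up to a factor, and in
expectation either gains energy or makes new constraints tight. -/
theorem exists_random_step [Finite κ] {A : κ → ι → ℝ} {β : κ → ℝ} {x : ι → ℝ}
    (hx : InPolyhedron A β x) {τ : Type} [Fintype τ] {w : τ → ℝ} {u : τ → ι → ℝ}
    (hw : ∀ k, 0 ≤ w k) (hw1 : ∑ k, w k = 1) (hu1 : ∀ k, ∑ i, u k i ^ 2 = 1)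
    (hu : ∀ k, ∀ v ∈ tightSpan A β x, ∑ i, v i * u k i = 0) {γ : ℝ} (hγ : 0 < γ) :
    ∃ (σ : Type) (_ : Fintype σ) (p : σ → ℝ) (Y : σ → ι → ℝ),
      (∀ k, 0 ≤ p k) ∧ ∑ k, p k = 1 ∧
      (∀ k, ∃ l s, Y k = s • u l ∧ |s| ≤ γ) ∧ (∀ k, InPolyhedron A β (x + Y k)) ∧
      (∀ i, ∑ k, p k * Y k i = 0) ∧
      (∃ c, 0 < c ∧ ∀ a : ι → ℝ, ∑ k, p k * (∑ i, a i * Y k i) ^ 2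
        = c * ∑ k, w k * (∑ i, a i * u k i) ^ 2) ∧
      1 ≤ ∑ k, p k * ((∑ i, Y k i ^ 2) / γ ^ 2 +
        2 * (Module.finrank ℝ (tightSpan A β (x + Y k)) -
          Module.finrank ℝ (tightSpan A β x))) := by
  choose α hα0 hαγ hαP hα using fun k => exists_step_size hx (hu k) hγ
  have hneg : ∀ k, ∀ v ∈ tightSpan A β x, ∑ i, v i * (-u k) i = 0 := by
    intro k v hv
    simpa using hu k v hv
  choose α' hα'0 hα'γ hα'P hα' using fun k => exists_step_size hx (hneg k) hγ
  set N := ∑ k, w k / (α k * α' k) with hN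
  have hN0 : 0 < N := by
    have h0 : ∀ k, 0 ≤ w k / (α k * α' k) := fun k =>
      div_nonneg (hw k) (mul_pos (hα0 k) (hα'0 k)).le
    obtain ⟨k, hk⟩ : ∃ k, 0 < w k := by
      by_contra! h
      have := Finset.sum_nonpos fun k (_ : k ∈ Finset.univ) => h k
      linarith
    exact Finset.sum_pos' (fun k _ => h0 k)
      ⟨k, Finset.mem_univ k, div_pos hk (mul_pos (hα0 k) (hα'0 k))⟩
  -- Forward and backward probabilities in ratio α' : α give mean zero, with conditional second
  -- moment αα'. The reweighting by 1/(αα') cancels it, so the covariance is exactly 1/N times the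
  -- given one.
  let p : τ × Bool → ℝ := fun k =>
    if k.2 then w k.1 / (N * α k.1 * (α k.1 + α' k.1)) else w k.1 / (N * α' k.1 * (α k.1 + α' k.1))
  let Y : τ × Bool → ι → ℝ := fun k => if k.2 then α k.1 • u k.1 else α' k.1 • -u k.1
  have hp : ∀ k, 0 ≤ p k := by
    rintro ⟨k, b⟩
    have := hα0 k
    have := hα'0 k
    have := hw k
    cases b <;> simp only [p] <;> positivity
  have hsum : ∑ k, p k = 1 := by
    rw [Fintype.sum_prod_type, ← div_self hN0.ne', hN, Finset.sum_div]
    refine Finset.sum_congr rfl fun k _ => ?_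
    have := hα0 k
    have := hα'0 k
    simp only [p, Fintype.sum_bool, if_true, ← hN]
    simp
    field_simp
    ring
  refine ⟨τ × Bool, inferInstance, p, Y, hp, hsum, ?_, ?_, ?_, ⟨N⁻¹, inv_pos.2 hN0, ?_⟩, ?_⟩
  · rintro ⟨k, b⟩
    cases b
    · exact ⟨k, -α' k, by simp [Y], by rw [abs_neg, abs_of_pos (hα'0 k)]; exact hα'γ k⟩
    · exact ⟨k, α k, by simp [Y], by rw [abs_of_pos (hα0 k)]; exact hαγ k⟩
  · rintro ⟨k, b⟩
    cases b
    · exact hα'P k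
    · exact hαP k
  · intro i
    rw [Fintype.sum_prod_type]
    refine Finset.sum_eq_zero fun k _ => ?_
    have := hα0 k
    have := hα'0 k
    simp only [p, Y, Fintype.sum_bool, if_true]
    simp
    field_simp
    ring
  · intro a
    rw [Fintype.sum_prod_type, Finset.mul_sum]
    refine Finset.sum_congr rfl fun k _ => ?_
    have := hα0 k
    have := hα'0 k
    have h1 : ∑ i, a i * (α k • u k) i = α k * ∑ i, a i * u k i := by
      rw [Finset.mul_sum]
      exact Finset.sum_congr rfl fun i _ => by simp only [Pi.smul_apply, smul_eq_mul]; ring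
    have h2 : ∑ i, a i * (α' k • -u k) i = -(α' k * ∑ i, a i * u k i) := by
      rw [Finset.mul_sum, ← Finset.sum_neg_distrib]
      exact Finset.sum_congr rfl fun i _ => by
        simp only [Pi.smul_apply, Pi.neg_apply, smul_eq_mul]; ring
    simp only [p, Y, Fintype.sum_bool, if_true, h1]
    simp only [Bool.false_eq_true, if_false, h2]
    field_simp
  · rw [← hsum, Fintype.sum_prod_type, Fintype.sum_prod_type]
    refine Finset.sum_le_sum fun k _ => ?_
    have h0 := hα0 k
    have h0' := hα'0 k
    have hYt : ∑ i, Y (k, true) i ^ 2 = α k ^ 2 := by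
      simp [Y, mul_pow, ← Finset.mul_sum, hu1]
    have hYf : ∑ i, Y (k, false) i ^ 2 = α' k ^ 2 := by
      simp [Y, mul_pow, ← Finset.mul_sum, hu1]
    simp only [Fintype.sum_bool, hYt, hYf]
    have hD1 : (0 : ℝ) ≤ Module.finrank ℝ (tightSpan A β (x + Y (k, true))) -
        Module.finrank ℝ (tightSpan A β x) :=
      sub_nonneg.2 (Nat.cast_le.2 (Submodule.finrank_mono (tightSpan_le_add_smul (hu k) _)))
    have hD2 : (0 : ℝ) ≤ Module.finrank ℝ (tightSpan A β (x + Y (k, false))) -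
        Module.finrank ℝ (tightSpan A β x) :=
      sub_nonneg.2 (Nat.cast_le.2 (Submodule.finrank_mono (tightSpan_le_add_smul (hneg k) _)))
    have hE1 : α k = γ ∨ (1 : ℝ) ≤ Module.finrank ℝ (tightSpan A β (x + Y (k, true))) -
        Module.finrank ℝ (tightSpan A β x) :=
      (hα k).imp id fun h => by
        have : (_ : ℝ) ≤ _ := Nat.cast_le.2 (Nat.succ_le_of_lt h)
        push_cast at this
        change (1 : ℝ) ≤ Module.finrank ℝ (tightSpan A β (x + α k • u k)) - _
        linarith
    have hE2 : α' k = γ ∨ (1 : ℝ) ≤ Module.finrank ℝ (tightSpan A β (x + Y (k, false))) -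
        Module.finrank ℝ (tightSpan A β x) :=
      (hα' k).imp id fun h => by
        have : (_ : ℝ) ≤ _ := Nat.cast_le.2 (Nat.succ_le_of_lt h)
        push_cast at this
        change (1 : ℝ) ≤ Module.finrank ℝ (tightSpan A β (x + α' k • -u k)) - _
        linarith
    generalize (Module.finrank ℝ (tightSpan A β (x + Y (k, true))) : ℝ) -
        Module.finrank ℝ (tightSpan A β x) = D1 at *
    generalize (Module.finrank ℝ (tightSpan A β (x + Y (k, false))) : ℝ) -
        Module.finrank ℝ (tightSpan A β x) = D2 at *
    have hW : 0 ≤ w k / (N * α k * α' k * (α k + α' k)) := by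
      have := hw k
      positivity
    have hpt : p (k, true) = w k / (N * α k * α' k * (α k + α' k)) * α' k := by
      simp only [p, if_true]
      field_simp
    have hpf : p (k, false) = w k / (N * α k * α' k * (α k + α' k)) * α k := by
      simp only [p, Bool.false_eq_true, if_false]
      field_simp
    rw [hpt, hpf]
    -- If only one side is blocked, it is the shorter one and so has conditional probability at
    -- least 1/2. The factor 2 on the rank gain compensates for this.
    have key : α' k + α k ≤ α' k * (α k ^ 2 / γ ^ 2 + 2 * D1) + α k * (α' k ^ 2 / γ ^ 2 + 2 * D2) := by
      have e1 : 0 ≤ α k ^ 2 / γ ^ 2 := by positivity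
      have e2 : 0 ≤ α' k ^ 2 / γ ^ 2 := by positivity
      rcases hE1 with h1 | h1 <;> rcases hE2 with h2 | h2
      · rw [h1, h2, div_self (by positivity)]
        nlinarith
      · have : α' k ≤ α k := h1 ▸ hα'γ k
        nlinarith [mul_nonneg h0'.le e1, mul_nonneg h0.le e2, mul_nonneg h0'.le hD1,
          mul_le_mul_of_nonneg_left h2 h0.le]
      · have : α k ≤ α' k := h2 ▸ hαγ k
        nlinarith [mul_nonneg h0'.le e1, mul_nonneg h0.le e2, mul_nonneg h0.le hD2,
          mul_le_mul_of_nonneg_left h1 h0'.le]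
      · nlinarith [mul_nonneg h0'.le e1, mul_nonneg h0.le e2,
          mul_le_mul_of_nonneg_left h1 h0'.le, mul_le_mul_of_nonneg_left h2 h0.le]
    nlinarith [mul_le_mul_of_nonneg_left key hW]

/-- One step of the exponential supermartingale for sub-isotropic mean zero increments. -/
theorem sum_exp_step_le {σ : Type*} [Fintype σ] {p : σ → ℝ} {Y : σ → ι → ℝ} {x a : ι → ℝ}
    {δ lam M : ℝ} (hδ : 0 < δ) (hδ1 : δ ≤ 1) (hp : ∀ k, 0 ≤ p k) (hp1 : ∑ k, p k = 1)
    (hmean : ∀ i, ∑ k, p k * Y k i = 0)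
    (hiso : ∀ a : ι → ℝ, δ * ∑ k, p k * (∑ i, a i * Y k i) ^ 2
      ≤ ∑ k, p k * ∑ i, a i ^ 2 * Y k i ^ 2)
    (hY : ∀ k, ∑ i, |Y k i| ≤ 1) (hx : ∀ i, 0 ≤ x i ∧ x i ≤ 1) (hM : ∀ i, |a i| ≤ M)
    (hM0 : 0 ≤ M) (hl : 0 ≤ lam) (hlM : lam * M ≤ δ / 12) :
    ∑ k, p k * Real.exp (lam * ∑ i, a i * (x + Y k) i +
        6 / δ * lam ^ 2 * ∑ i, a i ^ 2 * ((x + Y k) i - (x + Y k) i ^ 2)) ≤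
      Real.exp (lam * ∑ i, a i * x i + 6 / δ * lam ^ 2 * ∑ i, a i ^ 2 * (x i - x i ^ 2)) := by
  set c := 6 / δ * lam ^ 2 with hc
  have hc0 : 0 ≤ c := by positivity
  let s : σ → ℝ := fun k => ∑ i, a i * Y k i
  let b : σ → ℝ := fun k => ∑ i, (a i ^ 2 * (1 - 2 * x i)) * Y k i
  let v : σ → ℝ := fun k => ∑ i, a i ^ 2 * Y k i ^ 2
  let z : σ → ℝ := fun k => lam * s k + c * (b k - v k)
  have hsq : ∀ i, a i ^ 2 ≤ M ^ 2 := fun i => by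
    rw [← sq_abs]; exact pow_le_pow_left₀ (abs_nonneg _) (hM i) 2
  have hcM : c * M ^ 2 ≤ δ / 24 := by
    have h1 : (lam * M) ^ 2 ≤ (δ / 12) ^ 2 := pow_le_pow_left₀ (mul_nonneg hl hM0) hlM 2
    have h2 : c * M ^ 2 = 6 / δ * (lam * M) ^ 2 := by rw [hc]; ring
    rw [h2]
    calc 6 / δ * (lam * M) ^ 2 ≤ 6 / δ * (δ / 12) ^ 2 := by gcongr
      _ = δ / 24 := by field_simp; norm_num
  have hx2 : ∀ i, |1 - 2 * x i| ≤ 1 := fun i => by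
    rw [abs_le]; constructor <;> linarith [(hx i).1, (hx i).2]
  have hs : ∀ k, |s k| ≤ M := fun k => by
    calc |s k| ≤ ∑ i, |a i * Y k i| := Finset.abs_sum_le_sum_abs _ _
      _ ≤ ∑ i, M * |Y k i| := Finset.sum_le_sum fun i _ => by
          rw [abs_mul]; exact mul_le_mul_of_nonneg_right (hM i) (abs_nonneg _)
      _ ≤ M * 1 := by rw [← Finset.mul_sum]; exact mul_le_mul_of_nonneg_left (hY k) hM0
      _ = M := mul_one M
  have hb : ∀ k, |b k| ≤ M ^ 2 := fun k => by
    calc |b k| ≤ ∑ i, |(a i ^ 2 * (1 - 2 * x i)) * Y k i| := Finset.abs_sum_le_sum_abs _ _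
      _ ≤ ∑ i, M ^ 2 * |Y k i| := Finset.sum_le_sum fun i _ => by
          rw [abs_mul, abs_mul, abs_of_nonneg (sq_nonneg (a i))]
          refine mul_le_mul_of_nonneg_right ?_ (abs_nonneg _)
          calc a i ^ 2 * |1 - 2 * x i| ≤ M ^ 2 * 1 :=
                mul_le_mul (hsq i) (hx2 i) (abs_nonneg _) (sq_nonneg _)
            _ = M ^ 2 := mul_one _
      _ ≤ M ^ 2 * 1 := by
          rw [← Finset.mul_sum]; exact mul_le_mul_of_nonneg_left (hY k) (sq_nonneg _)
      _ = M ^ 2 := mul_one _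
  have hv0 : ∀ k, 0 ≤ v k := fun k =>
    Finset.sum_nonneg fun i _ => mul_nonneg (sq_nonneg _) (sq_nonneg _)
  have hv : ∀ k, v k ≤ M ^ 2 := fun k => by
    calc v k ≤ ∑ i, M ^ 2 * |Y k i| := Finset.sum_le_sum fun i _ => by
          refine mul_le_mul (hsq i) ?_ (sq_nonneg _) (sq_nonneg _)
          have h1 : |Y k i| ≤ 1 := (Finset.single_le_sum (f := fun i => |Y k i|)
            (fun i _ => abs_nonneg _) (Finset.mem_univ i)).trans (hY k)
          rw [← sq_abs]
          nlinarith [abs_nonneg (Y k i)]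
      _ ≤ M ^ 2 * 1 := by
          rw [← Finset.mul_sum]; exact mul_le_mul_of_nonneg_left (hY k) (sq_nonneg _)
      _ = M ^ 2 := mul_one _
  have hz1 : ∀ k, |z k| ≤ 1 := fun k => by
    have h1 : |lam * s k| ≤ δ / 12 := by
      rw [abs_mul, abs_of_nonneg hl]
      exact (mul_le_mul_of_nonneg_left (hs k) hl).trans hlM
    have h2 : |c * b k| ≤ δ / 24 := by
      rw [abs_mul, abs_of_nonneg hc0]
      exact (mul_le_mul_of_nonneg_left (hb k) hc0).trans hcM
    have h3 : c * v k ≤ δ / 24 := (mul_le_mul_of_nonneg_left (hv k) hc0).trans hcM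
    have h4 : 0 ≤ c * v k := mul_nonneg hc0 (hv0 k)
    have h5 : z k = lam * s k + c * b k - c * v k := by simp only [z]; ring
    rw [h5, abs_le]
    rw [abs_le] at h1 h2
    constructor <;> linarith
  have hexp : ∀ k, Real.exp (z k) ≤ 1 + z k +
      (3 * lam ^ 2 * s k ^ 2 + 3 * c ^ 2 * b k ^ 2 + 3 * c ^ 2 * M ^ 2 * v k) := fun k => by
    have h1 := (abs_le.1 (Real.abs_exp_sub_one_sub_id_le (hz1 k))).2
    have h2 : z k ^ 2 ≤ 3 * lam ^ 2 * s k ^ 2 + 3 * c ^ 2 * b k ^ 2 + 3 * c ^ 2 * v k ^ 2 := by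
      simp only [z]
      nlinarith [sq_nonneg (lam * s k - c * b k), sq_nonneg (lam * s k + c * v k),
        sq_nonneg (c * b k + c * v k)]
    have h3 : c ^ 2 * v k ^ 2 ≤ c ^ 2 * (M ^ 2 * v k) :=
      mul_le_mul_of_nonneg_left (by nlinarith [hv0 k, hv k]) (sq_nonneg c)
    linarith
  have hlin : ∀ f : ι → ℝ, ∑ k, p k * ∑ i, f i * Y k i = 0 := by
    intro f
    simp_rw [Finset.mul_sum]
    rw [Finset.sum_comm]
    refine Finset.sum_eq_zero fun i _ => ?_
    rw [← mul_zero (f i), ← hmean i, Finset.mul_sum]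
    exact Finset.sum_congr rfl fun k _ => by ring
  set V := ∑ k, p k * v k with hV
  have hV0 : 0 ≤ V := Finset.sum_nonneg fun k _ => mul_nonneg (hp k) (hv0 k)
  have hS2 : δ * ∑ k, p k * s k ^ 2 ≤ V := hiso a
  have hB2 : δ * ∑ k, p k * b k ^ 2 ≤ M ^ 2 * V := by
    refine (hiso _).trans ?_
    rw [hV, Finset.mul_sum]
    refine Finset.sum_le_sum fun k _ => ?_
    rw [mul_left_comm]
    refine mul_le_mul_of_nonneg_left ?_ (hp k)
    rw [Finset.mul_sum]
    refine Finset.sum_le_sum fun i _ => ?_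
    rw [← mul_assoc]
    refine mul_le_mul_of_nonneg_right ?_ (sq_nonneg _)
    have h1 : (1 - 2 * x i) ^ 2 ≤ 1 := (sq_le_one_iff_abs_le_one _).2 (hx2 i)
    calc (a i ^ 2 * (1 - 2 * x i)) ^ 2 = (a i ^ 2 * a i ^ 2) * (1 - 2 * x i) ^ 2 := by ring
      _ ≤ (M ^ 2 * a i ^ 2) * 1 := by
          refine mul_le_mul (mul_le_mul_of_nonneg_right (hsq i) (sq_nonneg _)) h1 (sq_nonneg _) ?_
          positivity
      _ = M ^ 2 * a i ^ 2 := mul_one _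
  -- The linear parts s and b average to zero, leaving drift -cV. The second-order terms cost at
  -- most cV/2, cV/8 and cV/8; c = 6λ²/δ is chosen so that the first, bounded through sub-isotropy
  -- by 3λ²V/δ, is half the drift.
  have htot : ∑ k, p k * Real.exp (z k) ≤ 1 := by
    calc ∑ k, p k * Real.exp (z k)
        ≤ ∑ k, p k * (1 + z k +
          (3 * lam ^ 2 * s k ^ 2 + 3 * c ^ 2 * b k ^ 2 + 3 * c ^ 2 * M ^ 2 * v k)) :=
          Finset.sum_le_sum fun k _ => mul_le_mul_of_nonneg_left (hexp k) (hp k)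
      _ = ∑ k, p k + lam * ∑ k, p k * s k + c * ∑ k, p k * b k - c * V +
          3 * lam ^ 2 * ∑ k, p k * s k ^ 2 + 3 * c ^ 2 * ∑ k, p k * b k ^ 2 +
          3 * c ^ 2 * M ^ 2 * V := by
          simp only [hV, Finset.mul_sum, ← Finset.sum_add_distrib, ← Finset.sum_sub_distrib]
          exact Finset.sum_congr rfl fun k _ => by simp only [z]; ring
      _ ≤ 1 := by
          rw [hp1, hlin a, hlin fun i => a i ^ 2 * (1 - 2 * x i)]
          have e1 : 3 * lam ^ 2 * ∑ k, p k * s k ^ 2 ≤ c / 2 * V := by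
            have : 3 * lam ^ 2 = c / 2 * δ := by rw [hc]; field_simp; ring
            rw [this, mul_assoc]
            exact mul_le_mul_of_nonneg_left hS2 (by positivity)
          have e2 : 3 * c ^ 2 * ∑ k, p k * b k ^ 2 ≤ c / 8 * V := by
            have h1 : ∑ k, p k * b k ^ 2 ≤ M ^ 2 * V / δ := by
              rw [le_div_iff₀ hδ]; linarith
            calc 3 * c ^ 2 * ∑ k, p k * b k ^ 2 ≤ 3 * c ^ 2 * (M ^ 2 * V / δ) := by gcongr
              _ = 3 * c * (c * M ^ 2) * (V / δ) := by ring
              _ ≤ 3 * c * (δ / 24) * (V / δ) := by gcongr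
              _ = c / 8 * V := by field_simp; ring
          have e3 : 3 * c ^ 2 * M ^ 2 * V ≤ c / 8 * V := by
            have : 3 * c ^ 2 * M ^ 2 ≤ c / 8 := by
              calc 3 * c ^ 2 * M ^ 2 = 3 * c * (c * M ^ 2) := by ring
                _ ≤ 3 * c * (1 / 24) := by gcongr; linarith
                _ = c / 8 := by ring
            exact mul_le_mul_of_nonneg_right this hV0
          nlinarith [mul_nonneg hc0 hV0]
  set T := lam * ∑ i, a i * x i + c * ∑ i, a i ^ 2 * (x i - x i ^ 2) with hT
  have hrew : ∀ k, lam * ∑ i, a i * (x + Y k) i +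
      c * ∑ i, a i ^ 2 * ((x + Y k) i - (x + Y k) i ^ 2) = T + z k := by
    intro k
    simp only [hT, z, s, b, v, Finset.mul_sum, ← Finset.sum_sub_distrib, ← Finset.sum_add_distrib,
      Pi.add_apply]
    exact Finset.sum_congr rfl fun i _ => by ring
  simp_rw [hrew, Real.exp_add, mul_left_comm (p _), ← Finset.mul_sum]
  exact mul_le_of_le_one_right (Real.exp_pos _).le htot

end Polytope

/-! ### Dimension bounds for the kept constraints. -/

theorem mem_alive {n : ℕ} {x : Fin n → ℝ} {i : Fin n} : i ∈ alive x ↔ 0 < x i ∧ x i < 1 := by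
  simp [alive]

/-- For a family of sets closed under union and intersection on which `x` has integral sums, the
indicator vectors restricted to the fractional coordinates span a space whose dimension is at most
the sum of the fractional values and at most the sum of their complements. -/
theorem finrank_span_ring_of_sets_le {n : ℕ} {x : Fin n → ℝ} (hx : ∀ i, 0 ≤ x i ∧ x i ≤ 1)
    (τ : Finset (Fin n) → Prop) (h0 : τ ∅) (h1 : τ Finset.univ)
    (hU : ∀ S, τ S → ∀ T, τ T → τ (S ∪ T)) (hI : ∀ S, τ S → ∀ T, τ T → τ (S ∩ T))
    (hint : ∀ T, τ T → ∃ z : ℤ, ∑ i ∈ T, x i = z) :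
    (Module.finrank ℝ (Submodule.span ℝ {w | ∃ T, τ T ∧ w = indVec (T ∩ alive x)}) : ℝ)
        ≤ ∑ i ∈ alive x, x i ∧
      (Module.finrank ℝ (Submodule.span ℝ {w | ∃ T, τ T ∧ w = indVec (T ∩ alive x)}) : ℝ)
        ≤ ∑ i ∈ alive x, (1 - x i) := by
  classical
  -- `D i` is the least member of the family containing i; below, `E i` is the largest member inside
  -- `D i` that avoids i. Their difference is the class of elements the family cannot separate from
  -- i, and its x-sum is integral.
  let D : Fin n → Finset (Fin n) := fun i => (Finset.univ.filter fun T => τ T ∧ i ∈ T).inf id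
  have hDmem : ∀ i j, j ∈ D i ↔ ∀ T, τ T → i ∈ T → j ∈ T := by
    intro i j
    simp [D, Finset.mem_inf]
  have hDτ : ∀ i, τ (D i) := fun i =>
    Finset.inf_induction (p := τ) h1 hI fun T hT => (Finset.mem_filter.1 hT).2.1
  have hself : ∀ i, i ∈ D i := fun i => (hDmem i i).2 fun T _ h => h
  have hDsub : ∀ i T, τ T → (D i ⊆ T ↔ i ∈ T) := fun i T hT =>
    ⟨fun h => h (hself i), fun h j hj => (hDmem i j).1 hj T hT h⟩
  let E : Fin n → Finset (Fin n) := fun i =>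
    (Finset.univ.filter fun T => τ T ∧ T ⊆ D i ∧ i ∉ T).sup id
  have hEτ : ∀ i, τ (E i) := fun i =>
    Finset.sup_induction (p := τ) h0 hU fun T hT => (Finset.mem_filter.1 hT).2.1
  have hEmem : ∀ i j, j ∈ E i ↔ ∃ T, (τ T ∧ T ⊆ D i ∧ i ∉ T) ∧ j ∈ T := by
    intro i j
    simp [E, Finset.mem_sup]
  have hED : ∀ i, E i ⊆ D i := fun i j hj => by
    obtain ⟨T, ⟨_, hT, _⟩, hjT⟩ := (hEmem i j).1 hj
    exact hT hjT
  have hclass : ∀ i j, j ∈ D i \ E i ↔ D j = D i := by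
    intro i j
    rw [Finset.mem_sdiff, hEmem]
    constructor
    · rintro ⟨hjD, hjE⟩
      have h1 : D j ⊆ D i := (hDsub j _ (hDτ i)).2 hjD
      refine h1.antisymm ((hDsub i _ (hDτ j)).2 ?_)
      by_contra h
      exact hjE ⟨D j, ⟨hDτ j, h1, h⟩, hself j⟩
    · intro h
      refine ⟨h ▸ hself j, ?_⟩
      rintro ⟨T, ⟨hT, _, hiT⟩, hjT⟩
      have : D j ⊆ T := (hDsub j T hT).2 hjT
      rw [h] at this
      exact hiT (this (hself i))
  -- One label per class meeting the alive set. The alive part of every member of the family is a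
  -- disjoint union of classes, so the dimension is at most `Q.card`. Frozen entries are integers,
  -- so the alive part of a class keeps an integral sum; being positive, it is at least 1, and
  -- likewise for 1 - x.
  let Q : Finset (Finset (Fin n)) := (alive x).image D
  let cl : Finset (Fin n) → Finset (Fin n) := fun Z => (alive x).filter fun j => D j = Z
  have hclint : ∀ Z ∈ Q, ∃ z : ℤ, ∑ j ∈ cl Z, x j = z := by
    intro Z hZ
    obtain ⟨i, hi, rfl⟩ := Finset.mem_image.1 hZ
    obtain ⟨z1, hz1⟩ := hint _ (hDτ i)
    obtain ⟨z2, hz2⟩ := hint _ (hEτ i)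
    have h2 : cl (D i) = (D i \ E i).filter (· ∈ alive x) := by
      ext j
      simp only [cl, Finset.mem_filter, hclass]
      tauto
    have h3 := Finset.sum_filter_add_sum_filter_not (D i \ E i) (· ∈ alive x) x
    have h4 : ∃ z : ℤ, ∑ j ∈ (D i \ E i).filter (· ∉ alive x), x j = z := by
      refine ⟨∑ j ∈ (D i \ E i).filter (· ∉ alive x), if x j = 0 then 0 else 1, ?_⟩
      push_cast
      refine Finset.sum_congr rfl fun j hj => ?_
      have := (Finset.mem_filter.1 hj).2
      rw [mem_alive, not_and_or] at this
      have hxj := hx j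
      split_ifs with h
      · exact h
      · rcases this with h' | h'
        · exact absurd (le_antisymm (not_lt.1 h') hxj.1) h
        · exact le_antisymm hxj.2 (not_lt.1 h')
    obtain ⟨z3, hz3⟩ := h4
    have h5 := Finset.sum_sdiff (f := x) (hED i)
    refine ⟨z1 - z2 - z3, ?_⟩
    push_cast
    rw [h2]
    linarith
  have hcl1 : ∀ Z ∈ Q, 1 ≤ ∑ j ∈ cl Z, x j := by
    intro Z hZ
    obtain ⟨z, hz⟩ := hclint Z hZ
    obtain ⟨i, hi, rfl⟩ := Finset.mem_image.1 hZ
    have hpos : 0 < ∑ j ∈ cl (D i), x j :=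
      Finset.sum_pos (fun j hj => (mem_alive.1 (Finset.mem_filter.1 hj).1).1)
        ⟨i, Finset.mem_filter.2 ⟨hi, rfl⟩⟩
    rw [hz] at hpos ⊢
    exact_mod_cast hpos
  have hcl2 : ∀ Z ∈ Q, 1 ≤ ∑ j ∈ cl Z, (1 - x j) := by
    intro Z hZ
    obtain ⟨z, hz⟩ := hclint Z hZ
    obtain ⟨i, hi, rfl⟩ := Finset.mem_image.1 hZ
    have hpos : 0 < ∑ j ∈ cl (D i), (1 - x j) :=
      Finset.sum_pos (fun j hj => sub_pos.2 (mem_alive.1 (Finset.mem_filter.1 hj).1).2)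
        ⟨i, Finset.mem_filter.2 ⟨hi, rfl⟩⟩
    have h2 : ∑ j ∈ cl (D i), (1 - x j) = (((cl (D i)).card - z : ℤ) : ℝ) := by
      rw [Finset.sum_sub_distrib, hz]
      simp
    rw [h2] at hpos ⊢
    exact_mod_cast hpos
  have hmaps : ∀ i ∈ alive x, D i ∈ Q := fun i hi => Finset.mem_image_of_mem D hi
  have hfr : Module.finrank ℝ (Submodule.span ℝ {w | ∃ T, τ T ∧ w = indVec (T ∩ alive x)})
      ≤ Q.card := by
    have hle : Submodule.span ℝ {w | ∃ T, τ T ∧ w = indVec (T ∩ alive x)} ≤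
        Submodule.span ℝ (((Q.image fun Z => indVec (cl Z)) : Finset (Fin n → ℝ)) : Set _) := by
      rw [Submodule.span_le]
      rintro _ ⟨T, hT, rfl⟩
      have : indVec (T ∩ alive x) = ∑ Z ∈ Q.filter (· ⊆ T), indVec (cl Z) := by
        ext j
        simp only [Finset.sum_apply, indVec, Finset.mem_inter, cl, Finset.mem_filter]
        by_cases hj : j ∈ alive x
        · simp only [hj, and_true, true_and]
          rw [Finset.sum_ite_eq]
          simp only [Finset.mem_filter, hmaps j hj, true_and, hDsub j T hT]
        · simp [hj]
      rw [SetLike.mem_coe, this]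
      refine Submodule.sum_mem _ fun Z hZ => Submodule.subset_span ?_
      exact Finset.mem_coe.2 (Finset.mem_image_of_mem _ (Finset.mem_filter.1 hZ).1)
    exact (Submodule.finrank_mono hle).trans
      ((finrank_span_finset_le_card _).trans Finset.card_image_le)
  have hfr' : (Module.finrank ℝ (Submodule.span ℝ {w | ∃ T, τ T ∧ w = indVec (T ∩ alive x)}) : ℝ)
      ≤ Q.card := Nat.cast_le.2 hfr
  constructor
  · rw [← Finset.sum_fiberwise_of_maps_to hmaps]
    refine hfr'.trans ?_
    simpa using Finset.sum_le_sum hcl1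
  · rw [← Finset.sum_fiberwise_of_maps_to hmaps]
    refine hfr'.trans ?_
    simpa using Finset.sum_le_sum hcl2

namespace DegMat

variable {n m : ℕ} (D : DegMat n m)

theorem coe_rank (T : Finset (Fin n)) : (D.rank T : ℕ∞) = D.M.eRk (T : Set (Fin n)) := by
  refine ENat.natCast_toNat ?_
  refine ne_top_of_le_ne_top ?_ (D.M.eRk_le_encard _)
  simp

theorem rank_empty : D.rank ∅ = 0 := by
  simp [rank]

theorem rank_inter_add_rank_union_le (S T : Finset (Fin n)) :
    D.rank (S ∩ T) + D.rank (S ∪ T) ≤ D.rank S + D.rank T := by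
  have := D.M.eRk_inter_add_eRk_union_le (S : Set (Fin n)) T
  rw [← Finset.coe_inter, ← Finset.coe_union] at this
  simp only [← coe_rank] at this
  exact_mod_cast this

/-- Uncrossing: x-sums are modular and rank is submodular, so both rank inequalities must be
equalities. -/
theorem tight_inter_union {x : Fin n → ℝ} (hx : D.InBasePolytope x) {S T : Finset (Fin n)}
    (hS : ∑ i ∈ S, x i = D.rank S) (hT : ∑ i ∈ T, x i = D.rank T) :
    ∑ i ∈ S ∩ T, x i = D.rank (S ∩ T) ∧ ∑ i ∈ S ∪ T, x i = D.rank (S ∪ T) := by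
  have h1 := Finset.sum_union_inter (s₁ := S) (s₂ := T) (f := x)
  have h2 : (D.rank (S ∩ T) : ℝ) + D.rank (S ∪ T) ≤ D.rank S + D.rank T := by
    exact_mod_cast D.rank_inter_add_rank_union_le S T
  have h3 := hx.2.1 (S ∩ T)
  have h4 := hx.2.1 (S ∪ T)
  constructor <;> linarith

theorem card_filter_mem_le_q (i : Fin n) : (Finset.univ.filter fun j => i ∈ D.S j).card ≤ D.q :=
  Finset.le_sup (f := fun i => (Finset.univ.filter fun j => i ∈ D.S j).card) (Finset.mem_univ i)

/-- Double counting: each alive element contributes 1 - x i to at most q excesses. -/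
theorem sum_excess_le (x : Fin n → ℝ) :
    ∑ j, D.excess x j ≤ D.q * ∑ i ∈ alive x, (1 - x i) := by
  have : ∀ j, D.excess x j = ∑ i ∈ alive x, if i ∈ D.S j then 1 - x i else 0 := fun j => by
    rw [excess, ← Finset.filter_mem_eq_inter, Finset.sum_filter]
  simp_rw [this]
  rw [Finset.sum_comm, Finset.mul_sum]
  refine Finset.sum_le_sum fun i hi => ?_
  rw [← Finset.sum_filter, Finset.sum_const, nsmul_eq_mul]
  exact mul_le_mul_of_nonneg_right (Nat.cast_le.2 (D.card_filter_mem_le_q i))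
    (sub_pos.2 (mem_alive.1 hi).2).le

/-- The protected degree constraints span a space of dimension at most `1 - 2δ` times the total
distance of the alive variables from `1`. -/
theorem finrank_span_protected_le {δ : ℝ} (hδ : δ < 1 / 2) (x : Fin n → ℝ) :
    (Module.finrank ℝ (Submodule.span ℝ
      {w | ∃ j : Fin m, D.threshold δ ≤ D.excess x j ∧ w = indVec (D.S j ∩ alive x)}) : ℝ) ≤
      (1 - 2 * δ) * ∑ i ∈ alive x, (1 - x i) := by
  classical
  -- Sets without alive elements give the zero vector. Discarding them matters when q = 0: the
  -- threshold is then 0 and every j counts as protected.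
  let J : Finset (Fin m) := Finset.univ.filter fun j =>
    D.threshold δ ≤ D.excess x j ∧ (D.S j ∩ alive x).Nonempty
  have h12 : 0 < 1 - 2 * δ := by linarith
  have hle : Submodule.span ℝ
      {w | ∃ j : Fin m, D.threshold δ ≤ D.excess x j ∧ w = indVec (D.S j ∩ alive x)} ≤
      Submodule.span ℝ (((J.image fun j => indVec (D.S j ∩ alive x)) : Finset (Fin n → ℝ)) : Set _) := by
    rw [Submodule.span_le]
    rintro _ ⟨j, hj, rfl⟩
    by_cases h : (D.S j ∩ alive x).Nonempty
    · exact Submodule.subset_span (Finset.mem_coe.2 (Finset.mem_image_of_mem _ (by simp [J, hj, h])))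
    · rw [Finset.not_nonempty_iff_eq_empty.1 h]
      have : indVec (∅ : Finset (Fin n)) = 0 := by ext; simp [indVec]
      rw [this]
      exact Submodule.zero_mem _
  have hfr : (Module.finrank ℝ (Submodule.span ℝ
      {w | ∃ j : Fin m, D.threshold δ ≤ D.excess x j ∧ w = indVec (D.S j ∩ alive x)}) : ℝ) ≤
      J.card := Nat.cast_le.2 ((Submodule.finrank_mono hle).trans
        ((finrank_span_finset_le_card _).trans Finset.card_image_le))
  have hA0 : 0 ≤ ∑ i ∈ alive x, (1 - x i) :=
    Finset.sum_nonneg fun i hi => (sub_pos.2 (mem_alive.1 hi).2).le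
  refine hfr.trans ?_
  rcases J.eq_empty_or_nonempty with hJ | ⟨j, hj⟩
  · rw [hJ]
    simpa using mul_nonneg h12.le hA0
  · obtain ⟨i, hi⟩ := (Finset.mem_filter.1 hj).2.2
    have hq : 0 < D.q := lt_of_lt_of_le
      (Finset.card_pos.2 ⟨j, by simpa using (Finset.mem_inter.1 hi).1⟩) (D.card_filter_mem_le_q i)
    have hq' : (0 : ℝ) < D.q := Nat.cast_pos.2 hq
    have hnn : ∀ j, 0 ≤ D.excess x j := fun j => Finset.sum_nonneg fun i hi =>
      (sub_pos.2 (mem_alive.1 (Finset.mem_inter.1 hi).1).2).le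
    have h1 : (J.card : ℝ) * D.threshold δ ≤ ∑ j, D.excess x j := by
      rw [← nsmul_eq_mul, ← Finset.sum_const]
      exact (Finset.sum_le_sum fun j hj => (Finset.mem_filter.1 hj).2.1).trans
        (Finset.sum_le_sum_of_subset_of_nonneg (Finset.subset_univ _) fun j _ _ => hnn j)
    have h2 := h1.trans (D.sum_excess_le x)
    rw [threshold, mul_div_assoc', div_le_iff₀ h12] at h2
    nlinarith

/-- With k alive elements of sum s, the bounds are s + (1 - 2δ)(k - s) and (2 - 2δ)(k - s). The
first suffices when s ≤ k/2, the second when s ≥ k/2. -/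
theorem finrank_constraintSpace_le {δ : ℝ} (hδ0 : 0 < δ) (hδ : δ < 1 / 2) {x : Fin n → ℝ}
    (hx : D.InBasePolytope x) :
    (Module.finrank ℝ (D.constraintSpace δ x) : ℝ) ≤ (1 - δ) * ((alive x).card : ℝ) := by
  have h1 := finrank_span_ring_of_sets_le hx.1 (fun T => ∑ i ∈ T, x i = (D.rank T : ℝ))
    (by simp [D.rank_empty]) hx.2.2 (fun S hS T hT => (D.tight_inter_union hx hS hT).2)
    (fun S hS T hT => (D.tight_inter_union hx hS hT).1) fun T hT => ⟨D.rank T, by simpa using hT⟩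
  have h2 := D.finrank_span_protected_le hδ x
  have h3 : (Module.finrank ℝ (D.constraintSpace δ x) : ℝ) ≤
      Module.finrank ℝ (Submodule.span ℝ {w | ∃ T : Finset (Fin n),
        ∑ i ∈ T, x i = (D.rank T : ℝ) ∧ w = indVec (T ∩ alive x)}) +
      Module.finrank ℝ (Submodule.span ℝ {w | ∃ j : Fin m,
        D.threshold δ ≤ D.excess x j ∧ w = indVec (D.S j ∩ alive x)}) := by
    rw [constraintSpace, Submodule.span_union]
    exact_mod_cast Submodule.finrank_add_le_finrank_add_finrank _ _
  have h4 : ∑ i ∈ alive x, (1 - x i) = (alive x).card - ∑ i ∈ alive x, x i := by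
    rw [Finset.sum_sub_distrib]; simp
  rw [h4] at h1 h2
  obtain ⟨h5, h6⟩ := h1
  rcases le_total (∑ i ∈ alive x, x i) ((alive x).card / 2 : ℝ) with h | h
  · nlinarith
  · nlinarith

end DegMat

theorem sum_indVec_mul {n : ℕ} (T : Finset (Fin n)) (x : Fin n → ℝ) :
    ∑ i, indVec T i * x i = ∑ i ∈ T, x i := by
  simp [indVec, Finset.sum_ite_mem]

/-! ### The base polytope as a polyhedron, and existence of a step. -/

namespace DegMat

variable {n m : ℕ} (D : DegMat n m)

/-- Normals of the inequalities describing the base polytope. -/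
def normal : (Fin n ⊕ Fin n) ⊕ Option (Finset (Fin n)) → Fin n → ℝ
  | Sum.inl (Sum.inl i) => -indVec {i}
  | Sum.inl (Sum.inr i) => indVec {i}
  | Sum.inr (some T) => indVec T
  | Sum.inr none => -indVec Finset.univ

/-- Right-hand sides of the inequalities describing the base polytope. -/
def bound : (Fin n ⊕ Fin n) ⊕ Option (Finset (Fin n)) → ℝ
  | Sum.inl (Sum.inl _) => 0
  | Sum.inl (Sum.inr _) => 1
  | Sum.inr (some T) => D.rank T
  | Sum.inr none => -D.rank Finset.univ

theorem inPolyhedron_iff (x : Fin n → ℝ) :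
    InPolyhedron normal D.bound x ↔ D.InBasePolytope x := by
  simp only [InPolyhedron, InBasePolytope, Sum.forall, Option.forall, normal, bound,
    Pi.neg_apply, neg_mul, Finset.sum_neg_distrib, sum_indVec_mul, Finset.sum_singleton]
  constructor
  · rintro ⟨⟨h0, h1⟩, h2, h3⟩
    exact ⟨fun i => ⟨by linarith [h0 i], h1 i⟩, h3, le_antisymm (h3 _) (by linarith)⟩
  · rintro ⟨h0, h1, h2⟩
    exact ⟨⟨fun i => by linarith [(h0 i).1], fun i => (h0 i).2⟩, by linarith, h1⟩

/-- The constraint space only sees alive coordinates. Tight box constraints sit at frozen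
coordinates, where u vanishes, and for the same reason truncating a tight set to the alive part
loses nothing. -/
theorem sum_mul_eq_zero_of_mem_tightSpan {δ : ℝ} {x u : Fin n → ℝ} (hx : D.InBasePolytope x)
    (hu : ∀ i, i ∉ alive x → u i = 0) (huW : ∀ w ∈ D.constraintSpace δ x, ∑ i, w i * u i = 0) :
    ∀ w ∈ tightSpan normal D.bound x, ∑ i, w i * u i = 0 := by
  have hT : ∀ T : Finset (Fin n), ∑ i ∈ T, x i = D.rank T → ∑ i ∈ T, u i = 0 := by
    intro T hT
    have := huW _ (Submodule.subset_span (Or.inl ⟨T, hT, rfl⟩))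
    rw [sum_indVec_mul] at this
    rw [← this]
    refine (Finset.sum_subset Finset.inter_subset_left fun i hi hi' => hu i fun h => ?_).symm
    exact hi' (Finset.mem_inter.2 ⟨hi, h⟩)
  intro w hw
  induction hw using Submodule.span_induction with
  | mem w hw =>
    obtain ⟨c, hc, rfl⟩ := hw
    rw [Set.mem_ofPred_eq] at hc
    rcases c with (i | i) | (_ | T)
    · simp only [normal, bound, Pi.neg_apply, neg_mul, Finset.sum_neg_distrib, sum_indVec_mul,
        Finset.sum_singleton, neg_eq_zero] at hc ⊢
      exact hu i fun h => (mem_alive.1 h).1.ne' hc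
    · simp only [normal, bound, sum_indVec_mul, Finset.sum_singleton] at hc ⊢
      exact hu i fun h => (mem_alive.1 h).2.ne hc
    · simp only [normal, Pi.neg_apply, neg_mul, Finset.sum_neg_distrib, sum_indVec_mul,
        neg_eq_zero]
      exact hT _ hx.2.2
    · simp only [normal, bound, sum_indVec_mul] at hc ⊢
      exact hT T hc
  | zero => simp
  | add v w _ _ hv hw => simp [add_mul, Finset.sum_add_distrib, hv, hw]
  | smul c v _ hv => simp [mul_assoc, ← Finset.mul_sum, hv]

/-- The dimension of the span of the tight constraints of the base polytope. -/
def tightRank (x : Fin n → ℝ) : ℕ := Module.finrank ℝ (tightSpan normal D.bound x)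

theorem tightRank_le (x : Fin n → ℝ) : D.tightRank x ≤ n :=
  (Submodule.finrank_le _).trans_eq (by simp)

/-- `ν` is the law of `x + Y` for a finitely supported mean zero sub-isotropic increment `Y` that
respects the constraint space and, unless `x` is integral, makes progress in expectation. -/
def IsStep (δ : ℝ) (x : Fin n → ℝ) (ν : PMF (Fin n → ℝ)) : Prop :=
  ∃ (σ : Type) (_ : Fintype σ) (p : σ → ℝ) (Y : σ → Fin n → ℝ)
    (hp : ∑ k, ENNReal.ofReal (p k) = 1),
    ν = (PMF.ofFintype (fun k => ENNReal.ofReal (p k)) hp).map (fun k => x + Y k) ∧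
    (∀ k, 0 ≤ p k) ∧ ∑ k, p k = 1 ∧ (∀ k, D.InBasePolytope (x + Y k)) ∧
    (∀ k i, i ∉ alive x → Y k i = 0) ∧
    (∀ k, ∀ w ∈ D.constraintSpace δ x, ∑ i, w i * Y k i = 0) ∧
    (∀ k, ∑ i, |Y k i| ≤ 1) ∧ (∀ i, ∑ k, p k * Y k i = 0) ∧
    (∀ a : Fin n → ℝ, δ * ∑ k, p k * (∑ i, a i * Y k i) ^ 2
      ≤ ∑ k, p k * ∑ i, a i ^ 2 * Y k i ^ 2) ∧
    (¬ IsIntegral01 x → 1 ≤ ∑ k, p k * ((n : ℝ) ^ 2 * ∑ i, Y k i ^ 2 +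
      2 * (D.tightRank (x + Y k) - D.tightRank x)))

theorem isStep_pure (δ : ℝ) {x : Fin n → ℝ} (hx : D.InBasePolytope x) (hi : IsIntegral01 x) :
    D.IsStep δ x (PMF.pure x) := by
  refine ⟨Unit, inferInstance, fun _ => 1, fun _ => 0, by simp, ?_, by simp, by simp, by simpa,
    by simp, by simp, by simp, by simp, by simp, fun h => absurd hi h⟩
  simp only [add_zero]
  exact (PMF.map_const _ _).symm

theorem exists_isStep {δ : ℝ} (hδ0 : 0 < δ) (hδ : δ < 1 / 2) {x : Fin n → ℝ}
    (hx : D.InBasePolytope x) : ∃ ν, D.IsStep δ x ν := by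
  classical
  by_cases hint : IsIntegral01 x
  · exact ⟨_, D.isStep_pure δ hx hint⟩
  have hne : (alive x).Nonempty := by
    by_contra h
    rw [Finset.not_nonempty_iff_eq_empty] at h
    refine hint fun i => ?_
    have : i ∉ alive x := by simp [h]
    rw [mem_alive, not_and_or] at this
    rcases this with h' | h'
    · exact Or.inl (le_antisymm (not_lt.1 h') (hx.1 i).1)
    · exact Or.inr (le_antisymm (hx.1 i).2 (not_lt.1 h'))
  have hn : 0 < n := by
    obtain ⟨i, _⟩ := hne
    exact i.pos
  have hn' : (0 : ℝ) < n := Nat.cast_pos.2 hn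
  let W := D.constraintSpace δ x
  let ext : ({i // i ∈ alive x} → ℝ) → Fin n → ℝ := fun v i => if h : i ∈ alive x then v ⟨i, h⟩ else 0
  have hext : ∀ (f : Fin n → ℝ → ℝ), (∀ i, f i 0 = 0) → ∀ v,
      ∑ i, f i (ext v i) = ∑ i : {i // i ∈ alive x}, f i (v i) := by
    intro f hf v
    rw [← Finset.sum_subset (Finset.subset_univ (alive x)) fun i _ hi => by simp [ext, hi, hf],
      ← Finset.sum_coe_sort]
    exact Finset.sum_congr rfl fun i _ => by simp [ext]
  -- The kernel consists of the alive-supported directions orthogonal to W; by rank-nullity its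
  -- dimension is at least |A| - dim W ≥ δ|A|.
  let Ψ : ({i // i ∈ alive x} → ℝ) →ₗ[ℝ] Module.Dual ℝ W :=
    { toFun := fun v =>
        { toFun := fun w => ∑ i : {i // i ∈ alive x}, w.1 i * v i
          map_add' := fun w w' => by simp [add_mul, Finset.sum_add_distrib]
          map_smul' := fun c w => by simp [Finset.mul_sum, mul_assoc] }
      map_add' := fun v v' => by ext w; simp [mul_add, Finset.sum_add_distrib]
      map_smul' := fun c v => by ext w; simp [Finset.mul_sum, mul_left_comm] }
  have hdim := D.finrank_constraintSpace_le hδ0 hδ hx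
  have hA : (0 : ℝ) < (alive x).card := Nat.cast_pos.2 hne.card_pos
  have hker : δ * Fintype.card {i // i ∈ alive x} ≤ Module.finrank ℝ (LinearMap.ker Ψ) := by
    have h1 := LinearMap.finrank_range_add_finrank_ker Ψ
    have h2 : Module.finrank ℝ (LinearMap.range Ψ) ≤ Module.finrank ℝ W := by
      rw [← Subspace.dual_finrank_eq (K := ℝ) (V := W)]
      exact Submodule.finrank_le _
    rw [Module.finrank_fintype_fun_eq_card] at h1
    have h3 : (Fintype.card {i // i ∈ alive x} : ℝ) ≤
        Module.finrank ℝ W + Module.finrank ℝ (LinearMap.ker Ψ) := by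
      exact_mod_cast h1.symm.le.trans (Nat.add_le_add_right h2 _)
    rw [Fintype.card_coe] at h3 ⊢
    change (Module.finrank ℝ W : ℝ) ≤ _ at hdim
    linarith
  have hpos : 0 < Module.finrank ℝ (LinearMap.ker Ψ) := by
    have : (0 : ℝ) < Module.finrank ℝ (LinearMap.ker Ψ) := by
      refine lt_of_lt_of_le ?_ hker
      rw [Fintype.card_coe]
      positivity
    exact_mod_cast this
  obtain ⟨τ, _, w, u, hw, hw1, huL, hu1, hiso⟩ :=
    exists_subisotropic (LinearMap.ker Ψ) hδ0.le hker hpos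
  have huA : ∀ k i, i ∉ alive x → ext (u k) i = 0 := fun k i hi => by simp [ext, hi]
  have huW : ∀ k, ∀ v ∈ D.constraintSpace δ x, ∑ i, v i * ext (u k) i = 0 := by
    intro k v hv
    rw [hext (fun i t => v i * t) (by simp)]
    exact LinearMap.congr_fun (LinearMap.mem_ker.1 (huL k)) (⟨v, hv⟩ : W)
  have hsq : ∀ k, ∑ i, ext (u k) i ^ 2 = 1 := fun k => by
    rw [hext (fun _ t => t ^ 2) (by simp)]
    exact hu1 k
  -- Step bound γ = 1/n: unit directions then give increments of ℓ¹ norm at most 1, and 1/γ² is the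
  -- factor n² in the progress condition.
  obtain ⟨σ, _, p, Y, hp, hp1, hYu, hYP, hmean, ⟨c, hc, hcov⟩, hprog⟩ :=
    exists_random_step ((D.inPolyhedron_iff x).2 hx) hw hw1 hsq
      (fun k => D.sum_mul_eq_zero_of_mem_tightSpan hx (huA k) (huW k)) (inv_pos.2 hn')
  refine ⟨_, σ, inferInstance, p, Y, ?_, rfl, hp, hp1, fun k => (D.inPolyhedron_iff _).1 (hYP k),
    ?_, ?_, ?_, hmean, ?_, fun _ => ?_⟩
  · rw [← ENNReal.ofReal_sum_of_nonneg fun k _ => hp k, hp1, ENNReal.ofReal_one]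
  · intro k i hi
    obtain ⟨l, s, h, -⟩ := hYu k
    simp [h, huA l i hi]
  · intro k v hv
    obtain ⟨l, s, h, -⟩ := hYu k
    simp only [h, Pi.smul_apply, smul_eq_mul, mul_left_comm _ s, ← Finset.mul_sum, huW l v hv,
      mul_zero]
  · intro k
    obtain ⟨l, s, h, hs⟩ := hYu k
    have h1 : ∀ i, |Y k i| ≤ (n : ℝ)⁻¹ := fun i => by
      have h2 : |ext (u l) i| ≤ 1 := by
        rw [← sq_le_one_iff_abs_le_one, ← hsq l]
        exact Finset.single_le_sum (f := fun i => ext (u l) i ^ 2) (fun i _ => sq_nonneg _)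
          (Finset.mem_univ i)
      rw [h, Pi.smul_apply, smul_eq_mul, abs_mul]
      calc |s| * |ext (u l) i| ≤ (n : ℝ)⁻¹ * 1 :=
            mul_le_mul hs h2 (abs_nonneg _) (inv_nonneg.2 hn'.le)
        _ = (n : ℝ)⁻¹ := mul_one _
    calc ∑ i, |Y k i| ≤ ∑ _i : Fin n, (n : ℝ)⁻¹ := Finset.sum_le_sum fun i _ => h1 i
      _ = 1 := by simp [hn'.ne']
  · intro a
    have h1 := hiso fun i => a i
    have h2 : ∀ b : Fin n → ℝ, ∑ k, w k * (∑ i, b i * ext (u k) i) ^ 2 =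
        ∑ k, w k * (∑ i : {i // i ∈ alive x}, b i * u k i) ^ 2 := fun b =>
      Finset.sum_congr rfl fun k _ => by rw [hext (fun i t => b i * t) (by simp)]
    have h3 : ∑ k, p k * ∑ i, a i ^ 2 * Y k i ^ 2 =
        c * ∑ k, w k * ∑ i : {i // i ∈ alive x}, a i ^ 2 * u k i ^ 2 := by
      have h4 : ∀ i, ∑ k, p k * Y k i ^ 2 = c * ∑ k, w k * ext (u k) i ^ 2 := fun i => by
        have := hcov (Pi.single i 1)
        simpa [Pi.single_apply] using this
      calc ∑ k, p k * ∑ i, a i ^ 2 * Y k i ^ 2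
          = ∑ i, a i ^ 2 * ∑ k, p k * Y k i ^ 2 := by
            simp_rw [Finset.mul_sum]
            rw [Finset.sum_comm]
            exact Finset.sum_congr rfl fun i _ => Finset.sum_congr rfl fun k _ => by ring
        _ = c * ∑ k, w k * ∑ i, a i ^ 2 * ext (u k) i ^ 2 := by
            simp_rw [h4, Finset.mul_sum]
            rw [Finset.sum_comm]
            exact Finset.sum_congr rfl fun i _ => Finset.sum_congr rfl fun k _ => by ring
        _ = _ := by
            congr 1
            exact Finset.sum_congr rfl fun k _ => by
              rw [hext (fun i t => a i ^ 2 * t ^ 2) (by simp)]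
    rw [hcov, h2, h3, mul_left_comm]
    exact mul_le_mul_of_nonneg_left h1 hc.le
  · refine hprog.trans_eq (Finset.sum_congr rfl fun k _ => ?_)
    rw [inv_pow, div_inv_eq_mul, mul_comm (∑ i, Y k i ^ 2)]
    rfl

end DegMat

/-! ### Expectations of nonnegative functions under a `PMF`. -/

section PMFExpectation

variable {α β : Type*}

/-- Expectation of an extended nonnegative function. -/
def PMF.lexpect (p : PMF α) (g : α → ENNReal) : ENNReal := ∑' a, p a * g a

theorem PMF.lexpect_pure (a : α) (g : α → ENNReal) : (PMF.pure a).lexpect g = g a := by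
  rw [PMF.lexpect, tsum_eq_single a fun b hb => by rw [PMF.pure_apply_of_ne _ _ hb, zero_mul],
    PMF.pure_apply_self, one_mul]

theorem PMF.lexpect_bind (p : PMF α) (f : α → PMF β) (g : β → ENNReal) :
    (p.bind f).lexpect g = p.lexpect fun a => (f a).lexpect g := by
  simp only [PMF.lexpect, PMF.bind_apply, ← ENNReal.tsum_mul_right, ← ENNReal.tsum_mul_left]
  rw [ENNReal.tsum_comm]
  simp only [mul_assoc]

theorem PMF.lexpect_map (p : PMF α) (f : α → β) (g : β → ENNReal) :
    (p.map f).lexpect g = p.lexpect (g ∘ f) := by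
  rw [PMF.map, PMF.lexpect_bind]
  simp [Function.comp_def, PMF.lexpect_pure]

theorem PMF.lexpect_mono (p : PMF α) {f g : α → ENNReal} (h : ∀ a ∈ p.support, f a ≤ g a) :
    p.lexpect f ≤ p.lexpect g := by
  refine ENNReal.tsum_le_tsum fun a => ?_
  by_cases ha : p a = 0
  · simp [ha]
  · gcongr
    exact h a ha

theorem PMF.lexpect_add (p : PMF α) (f g : α → ENNReal) :
    p.lexpect (fun a => f a + g a) = p.lexpect f + p.lexpect g := by
  simp only [PMF.lexpect, mul_add]
  exact ENNReal.tsum_add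

theorem PMF.lexpect_indicator (p : PMF α) (s : Set α) :
    p.lexpect (s.indicator fun _ => 1) = p.toOuterMeasure s := by
  rw [PMF.toOuterMeasure_apply, PMF.lexpect]
  refine tsum_congr fun a => ?_
  by_cases h : a ∈ s <;> simp [h]

end PMFExpectation

/-! ### Consequences of a single step: martingales, potential, degrees. -/

namespace DegMat

variable {n m : ℕ} {D : DegMat n m} {δ : ℝ} {x : Fin n → ℝ} {ν : PMF (Fin n → ℝ)}

theorem IsStep.support_finite (h : D.IsStep δ x ν) : ν.support.Finite := by
  obtain ⟨σ, _, p, Y, hp, rfl, -⟩ := h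
  rw [PMF.support_map]
  exact (Set.toFinite _).image _

theorem IsStep.of_mem_support (h : D.IsStep δ x ν) {x' : Fin n → ℝ} (hx' : x' ∈ ν.support) :
    D.InBasePolytope x' ∧ (∀ i, i ∉ alive x → x' i = x i) ∧
      ∀ w ∈ D.constraintSpace δ x, ∑ i, w i * (x' i - x i) = 0 := by
  obtain ⟨σ, _, p, Y, hp, rfl, -, -, hP, hA, hW, -⟩ := h
  rw [PMF.support_map] at hx'
  obtain ⟨k, -, rfl⟩ := hx'
  refine ⟨hP k, fun i hi => by simp [hA k i hi], fun w hw => ?_⟩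
  simpa using hW k w hw

theorem lexpect_map_ofFintype {σ : Type} [Fintype σ] {p : σ → ℝ}
    (hp : ∑ k, ENNReal.ofReal (p k) = 1) (hp0 : ∀ k, 0 ≤ p k) (Y : σ → Fin n → ℝ)
    {g : (Fin n → ℝ) → ℝ} (hg : ∀ k, 0 ≤ g (Y k)) :
    ((PMF.ofFintype (fun k => ENNReal.ofReal (p k)) hp).map Y).lexpect
      (fun y => ENNReal.ofReal (g y)) = ENNReal.ofReal (∑ k, p k * g (Y k)) := by
  rw [PMF.lexpect_map, PMF.lexpect, tsum_fintype,
    ENNReal.ofReal_sum_of_nonneg fun k _ => mul_nonneg (hp0 k) (hg k)]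
  exact Finset.sum_congr rfl fun k _ => by
    rw [PMF.ofFintype_apply, ENNReal.ofReal_mul (hp0 k)]
    rfl

theorem IsStep.lexpect_coord (h : D.IsStep δ x ν) (i : Fin n) :
    ν.lexpect (fun y => ENNReal.ofReal (y i)) = ENNReal.ofReal (x i) ∧
      ν.lexpect (fun y => ENNReal.ofReal (1 - y i)) = ENNReal.ofReal (1 - x i) := by
  obtain ⟨σ, _, p, Y, hp, rfl, hp0, hp1, hP, -, -, -, hmean, -⟩ := h
  have hs : ∑ k, p k * (x + Y k) i = x i := by
    simp only [Pi.add_apply, mul_add, Finset.sum_add_distrib, ← Finset.sum_mul, hp1, hmean]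
    ring
  constructor
  · rw [lexpect_map_ofFintype hp hp0 _ (g := fun y => y i) fun k => ((hP k).1 i).1, hs]
  · rw [lexpect_map_ofFintype hp hp0 _ (g := fun y => 1 - y i) fun k =>
      sub_nonneg.2 ((hP k).1 i).2]
    simp only [mul_sub, Finset.sum_sub_distrib, mul_one, hp1, hs]

theorem IsStep.lexpect_exp_le (h : D.IsStep δ x ν) (hx : D.InBasePolytope x) (hδ : 0 < δ)
    (hδ1 : δ ≤ 1) {a : Fin n → ℝ} {M lam : ℝ} (hM : ∀ i, |a i| ≤ M)
    (hM0 : 0 ≤ M) (hl : 0 ≤ lam) (hlM : lam * M ≤ δ / 12) :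
    ν.lexpect (fun y => ENNReal.ofReal (Real.exp (lam * ∑ i, a i * y i +
        6 / δ * lam ^ 2 * ∑ i, a i ^ 2 * (y i - y i ^ 2)))) ≤
      ENNReal.ofReal (Real.exp (lam * ∑ i, a i * x i +
        6 / δ * lam ^ 2 * ∑ i, a i ^ 2 * (x i - x i ^ 2))) := by
  obtain ⟨σ, _, p, Y, hp, rfl, hp0, hp1, hP, -, -, hY, hmean, hiso, -⟩ := h
  rw [lexpect_map_ofFintype hp hp0 _ (g := fun y => Real.exp (lam * ∑ i, a i * y i +
        6 / δ * lam ^ 2 * ∑ i, a i ^ 2 * (y i - y i ^ 2))) fun k => (Real.exp_pos _).le]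
  exact ENNReal.ofReal_le_ofReal
    (sum_exp_step_le hδ hδ1 hp0 hp1 hmean hiso hY hx.1 hM hM0 hl hlM)

/-- The potential that drops by at least one in expectation in every iteration. -/
def potential (D : DegMat n m) (y : Fin n → ℝ) : ℝ :=
  (n : ℝ) ^ 2 * (n - ∑ i, y i ^ 2) + 2 * (n - D.tightRank y)

theorem potential_nonneg (D : DegMat n m) {y : Fin n → ℝ} (hy : ∀ i, 0 ≤ y i ∧ y i ≤ 1) :
    0 ≤ D.potential y := by
  have h1 : ∑ i, y i ^ 2 ≤ n := by
    have : ∑ i, y i ^ 2 ≤ ∑ _i : Fin n, (1 : ℝ) := Finset.sum_le_sum fun i _ => by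
      nlinarith [hy i]
    simpa using this
  have h2 : (D.tightRank y : ℝ) ≤ n := Nat.cast_le.2 (D.tightRank_le y)
  exact add_nonneg (mul_nonneg (sq_nonneg _) (sub_nonneg.2 h1))
    (mul_nonneg zero_le_two (sub_nonneg.2 h2))

/-- The true bound is n³ + 2n ≤ 3n⁴; the constant 36 is the one the concentration bound requires. -/
theorem potential_le (D : DegMat n m) (y : Fin n → ℝ) : D.potential y ≤ 36 * (n : ℝ) ^ 4 := by
  have h1 : (0 : ℝ) ≤ ∑ i, y i ^ 2 := Finset.sum_nonneg fun i _ => sq_nonneg _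
  have h2 : (0 : ℝ) ≤ D.tightRank y := Nat.cast_nonneg _
  have h3n : n ^ 3 ≤ n ^ 4 := by
    rw [pow_succ n 3]
    rcases n.eq_zero_or_pos with h | h
    · simp [h]
    · exact Nat.le_mul_of_pos_right _ h
  have h3 : (n : ℝ) ^ 3 ≤ (n : ℝ) ^ 4 := by exact_mod_cast h3n
  have h4 : (n : ℝ) ≤ (n : ℝ) ^ 4 := by exact_mod_cast Nat.le_self_pow (by norm_num) n
  unfold potential
  nlinarith [mul_nonneg (sq_nonneg (n : ℝ)) h1]

theorem IsStep.lexpect_potential_le (h : D.IsStep δ x ν) :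
    ν.lexpect (fun y => ENNReal.ofReal (D.potential y)) +
      {y : Fin n → ℝ | ¬ IsIntegral01 y}.indicator (fun _ => 1) x ≤
        ENNReal.ofReal (D.potential x) := by
  by_cases hi : IsIntegral01 x
  · have hfix : ∀ x' ∈ ν.support, x' = x := by
      intro x' hx'
      ext i
      refine (h.of_mem_support hx').2.1 i fun hmem => ?_
      have := mem_alive.1 hmem
      rcases hi i with h0 | h0 <;> simp [h0] at this
    rw [Set.indicator_of_notMem (by simpa using hi), add_zero]
    calc ν.lexpect (fun y => ENNReal.ofReal (D.potential y))
        ≤ ν.lexpect (fun _ => ENNReal.ofReal (D.potential x)) :=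
          ν.lexpect_mono fun y hy => by rw [hfix y hy]
      _ = ENNReal.ofReal (D.potential x) := by
          rw [PMF.lexpect, ENNReal.tsum_mul_right, PMF.tsum_coe, one_mul]
  · obtain ⟨σ, _, p, Y, hp, rfl, hp0, hp1, hP, -, -, -, hmean, -, hprog⟩ := h
    have hnn : ∀ k, 0 ≤ D.potential (x + Y k) := fun k => D.potential_nonneg (hP k).1
    rw [lexpect_map_ofFintype hp hp0 _ hnn, Set.indicator_of_mem (by simpa using hi),
      ← ENNReal.ofReal_one, ← ENNReal.ofReal_add
        (Finset.sum_nonneg fun k _ => mul_nonneg (hp0 k) (hnn k)) zero_le_one]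
    refine ENNReal.ofReal_le_ofReal ?_
    have hlin : ∑ k, p k * ∑ i, x i * Y k i = 0 := by
      simp_rw [Finset.mul_sum]
      rw [Finset.sum_comm]
      refine Finset.sum_eq_zero fun i _ => ?_
      rw [← mul_zero (x i), ← hmean i, Finset.mul_sum]
      exact Finset.sum_congr rfl fun k _ => by ring
    -- The cross term of the square averages to zero, so the expected drop is exactly the progress
    -- quantity of `IsStep`.
    have hexp : ∀ k, D.potential (x + Y k) = D.potential x -
        2 * (n : ℝ) ^ 2 * ∑ i, x i * Y k i - ((n : ℝ) ^ 2 * ∑ i, Y k i ^ 2 +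
          2 * (D.tightRank (x + Y k) - D.tightRank x)) := by
      intro k
      have : ∑ i, (x + Y k) i ^ 2 = ∑ i, x i ^ 2 + 2 * ∑ i, x i * Y k i + ∑ i, Y k i ^ 2 := by
        rw [Finset.mul_sum, ← Finset.sum_add_distrib, ← Finset.sum_add_distrib]
        exact Finset.sum_congr rfl fun i _ => by simp only [Pi.add_apply]; ring
      unfold potential
      rw [this]
      ring
    have htot : ∑ k, p k * D.potential (x + Y k) = D.potential x -
        ∑ k, p k * ((n : ℝ) ^ 2 * ∑ i, Y k i ^ 2 +
          2 * (D.tightRank (x + Y k) - D.tightRank x)) := by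
      simp_rw [hexp]
      simp only [mul_sub (p _), Finset.sum_sub_distrib, ← Finset.sum_mul, hp1, one_mul,
        mul_left_comm (p _) (2 * (n : ℝ) ^ 2), ← Finset.mul_sum, hlin, mul_zero, sub_zero]
    have := hprog hi
    linarith

/-- The guarantee on the degree of `j` maintained by the rounding: either the degree constraint
still holds, or even rounding up all fractional variables keeps the violation below the
threshold. -/
def DegreeInvariant (D : DegMat n m) (δ : ℝ) (y : Fin n → ℝ) (j : Fin m) : Prop :=
  ∑ i ∈ D.S j, y i ≤ D.b j ∨
    (((D.S j).filter fun i => y i ≠ 0).card : ℝ) < D.b j + D.threshold δ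

/-- Alive elements contribute y + (1 - y) = 1, frozen ones their value 0 or 1. -/
theorem sum_add_excess (D : DegMat n m) {y : Fin n → ℝ} (hy : ∀ i, 0 ≤ y i ∧ y i ≤ 1) (j : Fin m) :
    ∑ i ∈ D.S j, y i + D.excess y j = ((D.S j).filter fun i => y i ≠ 0).card := by
  have h1 : D.excess y j = ∑ i ∈ D.S j, if i ∈ alive y then 1 - y i else 0 := by
    rw [excess, Finset.inter_comm, ← Finset.filter_mem_eq_inter, Finset.sum_filter]
  rw [h1, ← Finset.sum_add_distrib, Finset.card_filter]
  push_cast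
  refine Finset.sum_congr rfl fun i _ => ?_
  have := hy i
  by_cases ha : i ∈ alive y
  · simp [ha, (mem_alive.1 ha).1.ne']
  · simp only [ha, if_false, add_zero]
    split_ifs with h0
    · rw [mem_alive, not_and_or] at ha
      rcases ha with h' | h'
      · exact absurd (le_antisymm (not_lt.1 h') this.1) h0
      · exact le_antisymm this.2 (not_lt.1 h')
    · exact not_not.1 h0

/-- A protected degree sum is unchanged. Losing protection with the degree constraint intact gives
the second alternative by `sum_add_excess`; that one is permanent, since frozen zeros stay zero and
the support can only shrink. -/
theorem IsStep.degreeInvariant (h : D.IsStep δ x ν) (hx : D.InBasePolytope x) {j : Fin m}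
    (hj : D.DegreeInvariant δ x j) {x' : Fin n → ℝ} (hx' : x' ∈ ν.support) :
    D.DegreeInvariant δ x' j := by
  obtain ⟨hP, hA, hW⟩ := h.of_mem_support hx'
  have hcard : (((D.S j).filter fun i => x' i ≠ 0).card : ℝ) ≤
      ((D.S j).filter fun i => x i ≠ 0).card := by
    refine Nat.cast_le.2 (Finset.card_le_card fun i hi => ?_)
    rw [Finset.mem_filter] at hi ⊢
    refine ⟨hi.1, fun h0 => hi.2 ?_⟩
    rw [hA i fun ha => (mem_alive.1 ha).1.ne' h0, h0]
  rcases hj with hj | hj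
  · by_cases hprot : D.threshold δ ≤ D.excess x j
    · left
      have h1 := hW _ (Submodule.subset_span (Or.inr ⟨j, hprot, rfl⟩))
      rw [sum_indVec_mul (D.S j ∩ alive x) fun i => x' i - x i] at h1
      have h2 : ∑ i ∈ D.S j, (x' i - x i) = 0 := by
        rw [← h1]
        refine (Finset.sum_subset Finset.inter_subset_left fun i hi hi' => ?_).symm
        exact sub_eq_zero.2 (hA i fun ha => hi' (Finset.mem_inter.2 ⟨hi, ha⟩))
      rw [Finset.sum_sub_distrib] at h2
      linarith
    · right
      have := D.sum_add_excess hx.1 j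
      push Not at hprot
      linarith
  · exact Or.inr (hcard.trans_lt hj)

theorem DegreeInvariant.lt {I : Finset (Fin n)} {j : Fin m}
    (h : D.DegreeInvariant δ (indVec I) j) (hδ : δ < 1 / 2) :
    ((I ∩ D.S j).card : ℝ) - D.b j < (D.q : ℝ) / (1 - 2 * δ) := by
  have hfil : (D.S j).filter (fun i => indVec I i ≠ 0) = I ∩ D.S j := by
    ext i
    simp [indVec, and_comm]
  have hsum : ∑ i ∈ D.S j, indVec I i = ((I ∩ D.S j).card : ℝ) := by
    simp [indVec, Finset.sum_ite_mem, Finset.inter_comm]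
  have h12 : 0 < 1 - 2 * δ := by linarith
  have hthr : 0 ≤ (D.q : ℝ) / (1 - 2 * δ) := div_nonneg (Nat.cast_nonneg _) h12.le
  rcases h with h | h
  · rw [hsum] at h
    -- Strictness needs a case split because q may be 0: an empty intersection uses b j > 0, a
    -- nonempty one forces q > 0.
    rcases (I ∩ D.S j).eq_empty_or_nonempty with he | ⟨i, hi⟩
    · have : (0 : ℝ) < D.b j := Nat.cast_pos.2 (D.b_pos j)
      rw [he]
      simp only [Finset.card_empty, Nat.cast_zero]
      linarith
    · have hq : 0 < D.q := lt_of_lt_of_le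
        (Finset.card_pos.2 ⟨j, by simpa using (Finset.mem_inter.1 hi).2⟩)
        (D.card_filter_mem_le_q i)
      have : 0 < (D.q : ℝ) / (1 - 2 * δ) := div_pos (Nat.cast_pos.2 hq) h12
      linarith
  · rw [hfil, threshold] at h
    linarith

theorem isBase_of_inBasePolytope {I : Finset (Fin n)} (h : D.InBasePolytope (indVec I)) :
    D.M.IsBase (I : Set (Fin n)) := by
  have h1 := h.2.1 I
  have h2 := h.2.2
  have hI : ∑ i ∈ I, indVec I i = (I.card : ℝ) := by simp [indVec]
  have hU : ∑ i, indVec I i = (I.card : ℝ) := by simp [indVec]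
  rw [hI, Nat.cast_le] at h1
  rw [hU, Nat.cast_inj] at h2
  have hr : (I : Set (Fin n)).encard ≤ D.M.eRk I := by
    rw [← D.coe_rank, Set.encard_coe_eq_coe_finsetCard]
    exact_mod_cast h1
  have hind : D.M.Indep (I : Set (Fin n)) :=
    (Matroid.indep_iff_eRk_eq_encard_of_finite I.finite_toSet).2
      ((D.M.eRk_le_encard _).antisymm hr)
  refine hind.isBase_of_maximal fun J hJ hIJ => ?_
  refine I.finite_toSet.eq_of_subset_of_encard_le hIJ ?_
  rw [← hJ.eRk_eq_encard, Set.encard_coe_eq_coe_finsetCard, h2, D.coe_rank]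
  exact D.M.eRk_mono (by simp)

end DegMat

/-! ### Integral points and the rounding algorithm. -/

theorem indVec_injective {n : ℕ} : Function.Injective (indVec : Finset (Fin n) → Fin n → ℝ) := by
  intro I J h
  ext i
  have := congrFun h i
  simp only [indVec] at this
  by_cases h1 : i ∈ I <;> by_cases h2 : i ∈ J <;> simp_all

theorem range_indVec {n : ℕ} :
    Set.range (indVec : Finset (Fin n) → Fin n → ℝ) = {y | IsIntegral01 y} := by
  classical
  ext y
  constructor
  · rintro ⟨I, rfl⟩ i
    by_cases h : i ∈ I <;> simp [indVec, h]
  · intro hy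
    refine ⟨Finset.univ.filter fun i => y i = 1, ?_⟩
    ext i
    rcases hy i with h | h <;> simp [indVec, h]

theorem sum_indVec_apply_mul {n : ℕ} (p : PMF (Fin n → ℝ)) (g : (Fin n → ℝ) → ENNReal) :
    ∑ I, p (indVec I) * g (indVec I) =
      ∑' y, {y | IsIntegral01 y}.indicator (fun y => p y * g y) y := by
  rw [← tsum_subtype, ← range_indVec, tsum_range (fun y => p y * g y) indVec_injective,
    tsum_fintype]

theorem sum_indVec_apply_mul_le {n : ℕ} (p : PMF (Fin n → ℝ)) (g : (Fin n → ℝ) → ENNReal) :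
    ∑ I, p (indVec I) * g (indVec I) ≤ p.lexpect g := by
  rw [sum_indVec_apply_mul]
  exact ENNReal.tsum_le_tsum fun y => Set.indicator_le_self _ _ y

theorem sum_indVec_apply_add {n : ℕ} (p : PMF (Fin n → ℝ)) :
    ∑ I, p (indVec I) + p.toOuterMeasure {y | ¬ IsIntegral01 y} = 1 := by
  have h := sum_indVec_apply_mul p fun _ => 1
  simp only [mul_one] at h
  rw [h, PMF.toOuterMeasure_apply, ← ENNReal.tsum_add, ← p.tsum_coe]
  refine tsum_congr fun y => ?_
  by_cases hy : IsIntegral01 y <;> simp [hy]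

open Classical in
/-- The sub-isotropic random walk rounding: move by a chosen sub-isotropic step. -/
def subisotropicRounding : RoundingAlgorithm := fun _ _ D δ x =>
  -- The default never occurs on the base polytope when 0 < δ < 1/2, by `exists_isStep`.
  if h : ∃ ν, D.IsStep δ x ν then h.choose else PMF.pure x

theorem isStep_subisotropicRounding {n m : ℕ} (D : DegMat n m) {δ : ℝ} (hδ0 : 0 < δ)
    (hδ : δ < 1 / 2) {x : Fin n → ℝ} (hx : D.InBasePolytope x) :
    D.IsStep δ x (subisotropicRounding n m D δ x) := by
  have h := D.exists_isStep hδ0 hδ hx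
  rw [subisotropicRounding, dif_pos h]
  exact h.choose_spec

theorem isIteratedRounding_subisotropicRounding : subisotropicRounding.IsIteratedRounding :=
  fun _ _ D _ hδ0 hδ _ hx => ⟨D.finrank_constraintSpace_le hδ0 hδ hx,
    (isStep_subisotropicRounding D hδ0 hδ hx).support_finite,
    fun _ hx' => (isStep_subisotropicRounding D hδ0 hδ hx).of_mem_support hx'⟩

/-! ### Law of the walk: running time and limit distribution. -/

namespace RoundingAlgorithm

variable {alg : RoundingAlgorithm} {n m : ℕ} {D : DegMat n m} {δ : ℝ} {x : Fin n → ℝ}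

theorem forall_mem_support_law {P : (Fin n → ℝ) → Prop} (h0 : P x)
    (hstep : ∀ y, P y → ∀ y' ∈ (alg n m D δ y).support, P y') (k : ℕ) :
    ∀ y ∈ (alg.law D δ x k).support, P y := by
  induction k with
  | zero =>
    intro y hy
    rw [law, PMF.mem_support_pure_iff] at hy
    exact hy ▸ h0
  | succ k ih =>
    intro y hy
    rw [law, PMF.mem_support_bind_iff] at hy
    obtain ⟨z, hz, hy⟩ := hy
    exact hstep z (ih z hz) y hy

theorem inBasePolytope_of_mem_support_law (hx : D.InBasePolytope x)
    (halg : ∀ y, D.InBasePolytope y → D.IsStep δ y (alg n m D δ y)) (k : ℕ) :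
    ∀ y ∈ (alg.law D δ x k).support, D.InBasePolytope y :=
  forall_mem_support_law hx (fun y hy _ hy' => ((halg y hy).of_mem_support hy').1) k

theorem lexpect_law_le (hx : D.InBasePolytope x)
    (halg : ∀ y, D.InBasePolytope y → D.IsStep δ y (alg n m D δ y))
    {g : (Fin n → ℝ) → ENNReal}
    (hg : ∀ y, D.InBasePolytope y → (alg n m D δ y).lexpect g ≤ g y) (k : ℕ) :
    (alg.law D δ x k).lexpect g ≤ g x := by
  induction k with
  | zero => exact (PMF.lexpect_pure x g).le
  | succ k ih =>
    rw [law, PMF.lexpect_bind]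
    exact (PMF.lexpect_mono _ fun y hy =>
      hg y (inBasePolytope_of_mem_support_law hx halg k y hy)).trans ih

/-- Telescoping: each iteration lowers the expected potential by at least the probability of not yet
being integral. -/
theorem expectedIterations_le (hx : D.InBasePolytope x)
    (halg : ∀ y, D.InBasePolytope y → D.IsStep δ y (alg n m D δ y)) :
    alg.expectedIterations D δ x ≤ ENNReal.ofReal (D.potential x) := by
  have h : ∀ N, ∑ k ∈ Finset.range N, (alg.law D δ x k).toOuterMeasure {y | ¬ IsIntegral01 y} +
      (alg.law D δ x N).lexpect (fun y => ENNReal.ofReal (D.potential y)) ≤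
        ENNReal.ofReal (D.potential x) := by
    intro N
    induction N with
    | zero => simp [law, PMF.lexpect_pure]
    | succ N ih =>
      refine le_trans ?_ ih
      rw [Finset.sum_range_succ, add_assoc]
      gcongr
      rw [law, PMF.lexpect_bind, ← PMF.lexpect_indicator, add_comm, ← PMF.lexpect_add]
      exact PMF.lexpect_mono _ fun y hy =>
        (halg y (inBasePolytope_of_mem_support_law hx halg N y hy)).lexpect_potential_le
  rw [expectedIterations, ENNReal.tsum_eq_iSup_nat]
  exact iSup_le fun N => le_self_add.trans (h N)

/-- Integral points are absorbing, so their masses increase to limits. The non-integral mass tends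
to 0 as the terms of a convergent series, so the limits sum to 1. -/
theorem exists_hasOutput (hx : D.InBasePolytope x)
    (halg : ∀ y, D.InBasePolytope y → D.IsStep δ y (alg n m D δ y)) :
    ∃ μ, alg.HasOutput D δ x μ := by
  have hmono : ∀ I, Monotone fun k => alg.law D δ x k (indVec I) := by
    intro I
    refine monotone_nat_of_le_succ fun k => ?_
    by_cases h0 : alg.law D δ x k (indVec I) = 0
    · simp [h0]
    have hP := inBasePolytope_of_mem_support_law hx halg k _ ((PMF.mem_support_iff _ _).2 h0)
    have hi : IsIntegral01 (indVec I) := by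
      have : indVec I ∈ Set.range indVec := ⟨I, rfl⟩
      rwa [range_indVec] at this
    have hfix : alg n m D δ (indVec I) (indVec I) = 1 := by
      rw [PMF.apply_eq_one_iff]
      refine Set.Subset.antisymm (fun y hy => ?_) ?_
      · ext i
        refine ((halg _ hP).of_mem_support hy).2.1 i fun hmem => ?_
        have := mem_alive.1 hmem
        rcases hi i with h0 | h0 <;> simp [h0] at this
      · rw [Set.singleton_subset_iff]
        obtain ⟨y, hy⟩ := (alg n m D δ (indVec I)).support_nonempty
        have : y = indVec I := by
          ext i
          refine ((halg _ hP).of_mem_support hy).2.1 i fun hmem => ?_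
          have := mem_alive.1 hmem
          rcases hi i with h0 | h0 <;> simp [h0] at this
        exact this ▸ hy
    calc alg.law D δ x k (indVec I)
        = alg.law D δ x k (indVec I) * alg n m D δ (indVec I) (indVec I) := by rw [hfix, mul_one]
      _ ≤ alg.law D δ x (k + 1) (indVec I) := by
          rw [law, PMF.bind_apply]
          exact ENNReal.le_tsum (f := fun y => alg.law D δ x k y * alg n m D δ y (indVec I)) _
  have htend : ∀ I, Tendsto (fun k => alg.law D δ x k (indVec I)) atTop
      (𝓝 (⨆ k, alg.law D δ x k (indVec I))) := fun I => tendsto_atTop_iSup (hmono I)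
  have hzero : Tendsto (fun k => (alg.law D δ x k).toOuterMeasure {y | ¬ IsIntegral01 y})
      atTop (𝓝 0) :=
    ENNReal.tendsto_atTop_zero_of_tsum_ne_top
      (ne_top_of_le_ne_top ENNReal.ofReal_ne_top (expectedIterations_le hx halg))
  have hsum : ∑ I, ⨆ k, alg.law D δ x k (indVec I) = 1 := by
    have h1 := (tendsto_finsetSum Finset.univ fun I _ => htend I).add hzero
    simp only [sum_indVec_apply_add, add_zero] at h1
    exact tendsto_nhds_unique h1 tendsto_const_nhds
  exact ⟨PMF.ofFintype _ hsum, htend⟩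

/-- Supermartingale bounds pass to the limit: the function is nonnegative, so discarding the
non-integral mass only decreases the expectation. -/
theorem sum_output_mul_le (hx : D.InBasePolytope x)
    (halg : ∀ y, D.InBasePolytope y → D.IsStep δ y (alg n m D δ y))
    {μ : PMF (Finset (Fin n))} (hμ : alg.HasOutput D δ x μ) {g : (Fin n → ℝ) → ℝ}
    (hg : ∀ y, D.InBasePolytope y → (alg n m D δ y).lexpect (fun y => ENNReal.ofReal (g y))
      ≤ ENNReal.ofReal (g y)) :
    ∑ I, μ I * ENNReal.ofReal (g (indVec I)) ≤ ENNReal.ofReal (g x) := by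
  refine le_of_tendsto' (tendsto_finsetSum Finset.univ fun I _ =>
    ENNReal.Tendsto.mul_const (hμ I) (Or.inr ENNReal.ofReal_ne_top)) fun k => ?_
  exact (sum_indVec_apply_mul_le _ fun y => ENNReal.ofReal (g y)).trans
    (lexpect_law_le hx halg hg k)

theorem of_mem_support_output {P : (Fin n → ℝ) → Prop}
    (hP : ∀ k, ∀ y ∈ (alg.law D δ x k).support, P y)
    {μ : PMF (Finset (Fin n))} (hμ : alg.HasOutput D δ x μ) {I : Finset (Fin n)}
    (hI : I ∈ μ.support) : P (indVec I) := by
  by_contra hcon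
  have h0 : ∀ k, alg.law D δ x k (indVec I) = 0 := fun k => by
    by_contra h
    exact hcon (hP k _ ((PMF.mem_support_iff _ _).2 h))
  have h1 := hμ I
  simp only [h0] at h1
  exact (PMF.mem_support_iff _ _).1 hI (tendsto_nhds_unique h1 tendsto_const_nhds)

end RoundingAlgorithm

/-! ### Bernstein concentration from exponential moments. -/

section Expectation

variable {n : ℕ} {μ : PMF (Finset (Fin n))}

theorem expect_le_of_sum_le {f : Finset (Fin n) → ℝ} {c : ℝ} (hf : ∀ I, 0 ≤ f I) (hc : 0 ≤ c)
    (h : ∑ I, μ I * ENNReal.ofReal (f I) ≤ ENNReal.ofReal c) : expect μ f ≤ c := by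
  have h1 := ENNReal.toReal_mono ENNReal.ofReal_ne_top h
  rw [ENNReal.toReal_ofReal hc, ENNReal.toReal_sum fun I _ =>
    ENNReal.mul_ne_top (μ.apply_ne_top I) ENNReal.ofReal_ne_top] at h1
  simpa [expect, ENNReal.toReal_ofReal, hf] using h1

theorem sum_toReal_apply : ∑ I, (μ I).toReal = 1 := by
  have h := μ.tsum_coe
  rw [tsum_fintype] at h
  rw [← ENNReal.toReal_sum fun I _ => μ.apply_ne_top I, h, ENNReal.toReal_one]

theorem expect_sum_mul (a : Fin n → ℝ) :
    expect μ (fun I => ∑ i, a i * indVec I i) = ∑ i, a i * expect μ fun I => indVec I i := by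
  simp only [expect, Finset.mul_sum]
  rw [Finset.sum_comm]
  exact Finset.sum_congr rfl fun i _ => Finset.sum_congr rfl fun I _ => by ring

theorem prob_le_one (A : Set (Finset (Fin n))) : prob μ A ≤ 1 := by
  refine ENNReal.toReal_le_of_le_ofReal zero_le_one ?_
  rw [ENNReal.ofReal_one, PMF.toOuterMeasure_apply, ← μ.tsum_coe]
  exact ENNReal.tsum_le_tsum fun I => Set.indicator_le_self _ _ I

/-- Markov's inequality. -/
theorem prob_le_expect {A : Set (Finset (Fin n))} {f : Finset (Fin n) → ℝ} (hf : ∀ I, 0 ≤ f I)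
    (hA : ∀ I ∈ A, 1 ≤ f I) : prob μ A ≤ expect μ f := by
  classical
  rw [prob, PMF.toOuterMeasure_apply, tsum_fintype, ENNReal.toReal_sum fun I _ =>
    ne_top_of_le_ne_top (μ.apply_ne_top I) (Set.indicator_le_self _ _ I)]
  refine Finset.sum_le_sum fun I _ => ?_
  by_cases h : I ∈ A
  · rw [Set.indicator_of_mem h]
    exact le_mul_of_one_le_right ENNReal.toReal_nonneg (hA I h)
  · rw [Set.indicator_of_notMem h]
    simpa using mul_nonneg ENNReal.toReal_nonneg (hf I)

/-- Bernstein-type concentration from an exponential moment bound for small parameters. -/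
theorem isConcentrated_of_expect_exp_le {x : Fin n → ℝ} {δ : ℝ} (hδ : 0 < δ) (hδ1 : δ ≤ 1)
    (hx : ∀ i, 0 ≤ x i ∧ x i ≤ 1) (hmean : ∀ i, expect μ (fun I => indVec I i) = x i)
    (hexp : ∀ (a : Fin n → ℝ) (M lam : ℝ), (∀ i, |a i| ≤ M) → 0 ≤ M → 0 ≤ lam →
      lam * M ≤ δ / 12 → expect μ (fun I => Real.exp (lam * ∑ i, a i * indVec I i)) ≤
        Real.exp (lam * ∑ i, a i * x i + 6 / δ * lam ^ 2 * ∑ i, a i ^ 2 * (x i - x i ^ 2))) :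
    IsConcentrated μ (36 / δ) := by
  refine ⟨by rw [le_div_iff₀ hδ]; linarith, fun a t ht => ?_⟩
  simp only [expect_sum_mul, hmean]
  set M := ⨆ i, |a i| with hMdef
  set V := ∑ i, a i ^ 2 * (x i - x i ^ 2) with hVdef
  have hM : ∀ i, |a i| ≤ M := fun i => le_ciSup (Set.finite_range fun i => |a i|).bddAbove i
  have hM0 : 0 ≤ M := Real.iSup_nonneg fun i => abs_nonneg _
  have hV0 : 0 ≤ V := Finset.sum_nonneg fun i _ => by
    have := hx i
    exact mul_nonneg (sq_nonneg _) (by nlinarith)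
  -- In the degenerate case the denominator is 0, so the quotient is 0 and the right-hand side is
  -- exp 0 = 1.
  rcases (add_nonneg hV0 (mul_nonneg hM0 ht)).eq_or_lt with h0 | hpos
  · have h1 : V = 0 := by nlinarith [mul_nonneg hM0 ht]
    have h2 : M * t = 0 := by linarith
    rw [h1, h2]
    simpa using prob_le_one _
  -- This λ is admissible (λM ≤ δ/12) and makes the variance term at most λt/2. The remaining
  -- exponent -λt/2 = -δt²/(24(V + Mt)) is at most the target -δt²/(72V + 24Mt), which is where β =
  -- 36/δ comes from.
  · set lam := δ * t / (12 * (V + M * t)) with hlam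
    have hl0 : 0 ≤ lam := by positivity
    have hlM : lam * M ≤ δ / 12 := by
      rw [hlam, div_mul_eq_mul_div, div_le_div_iff₀ (by positivity) (by norm_num)]
      nlinarith [mul_nonneg hδ.le hV0]
    have hmark : prob μ {I | t ≤ ∑ i, a i * indVec I i - ∑ i, a i * x i} ≤
        expect μ fun I => Real.exp (-(lam * (t + ∑ i, a i * x i))) *
          Real.exp (lam * ∑ i, a i * indVec I i) := by
      refine prob_le_expect (fun I => by positivity) fun I hI => ?_
      rw [← Real.exp_add, Real.one_le_exp_iff]
      have h3 : t ≤ ∑ i, a i * indVec I i - ∑ i, a i * x i := hI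
      nlinarith [mul_le_mul_of_nonneg_left h3 hl0]
    refine hmark.trans ?_
    have h4 : (expect μ fun I => Real.exp (-(lam * (t + ∑ i, a i * x i))) *
          Real.exp (lam * ∑ i, a i * indVec I i)) = Real.exp (-(lam * (t + ∑ i, a i * x i))) *
        expect μ fun I => Real.exp (lam * ∑ i, a i * indVec I i) := by
      simp only [expect, Finset.mul_sum]
      exact Finset.sum_congr rfl fun I _ => by ring
    rw [h4]
    refine (mul_le_mul_of_nonneg_left (hexp a M lam hM hM0 hl0 hlM) (Real.exp_pos _).le).trans ?_
    rw [← Real.exp_add, Real.exp_le_exp]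
    have h5 : 6 / δ * lam ^ 2 * V ≤ lam * t / 2 := by
      have : 6 / δ * lam ^ 2 * V = lam * t / 2 * (V / (V + M * t)) := by
        rw [hlam]
        field_simp
        ring
      rw [this]
      refine mul_le_of_le_one_right (by positivity) ?_
      rw [div_le_one hpos]
      linarith [mul_nonneg hM0 ht]
    have h6 : t ^ 2 / (36 / δ) / (2 * (V + M * t / 3)) ≤ lam * t / 2 := by
      have e1 : t ^ 2 / (36 / δ) / (2 * (V + M * t / 3)) = t ^ 2 * δ / (72 * V + 24 * (M * t)) := by
        rw [div_div, ← div_div_eq_mul_div (t ^ 2) (72 * V + 24 * (M * t)) δ]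
        congr 1
        ring
      have e2 : lam * t / 2 = t ^ 2 * δ / (24 * (V + M * t)) := by
        rw [hlam]
        field_simp
        ring
      rw [e1, e2]
      exact div_le_div_of_nonneg_left (by positivity) (by positivity) (by linarith)
    linarith

end Expectation

/-! ### Assembly of the main theorem. -/

theorem mainTheorem4 :
    ∃ (C : ℝ) (alg : RoundingAlgorithm), 0 < C ∧ alg.IsIteratedRounding ∧
      ∀ (n m : ℕ) (D : DegMat n m) (δ : ℝ), 0 < δ → δ < 1 / 2 →
        ∀ x : Fin n → ℝ, D.Feasible x →
          alg.expectedIterations D δ x ≤ ENNReal.ofReal (C * (n : ℝ) ^ 4) ∧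
          ∃ μ : PMF (Finset (Fin n)), alg.HasOutput D δ x μ ∧
            (∀ I ∈ μ.support, D.M.IsBase (I : Set (Fin n)) ∧
              ∀ j, ((I ∩ D.S j).card : ℝ) - (D.b j : ℝ) < (D.q : ℝ) / (1 - 2 * δ)) ∧
            (∀ i, expect μ (fun I => indVec I i) = x i) ∧
            expect μ (fun I => ∑ i ∈ I, D.cost i) = ∑ i, D.cost i * x i ∧
            IsConcentrated μ (C / δ) := by
  refine ⟨36, subisotropicRounding, by norm_num, isIteratedRounding_subisotropicRounding,
    fun n m D δ hδ0 hδ x hfeas => ?_⟩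
  have hx := hfeas.1
  have halg : ∀ y, D.InBasePolytope y → D.IsStep δ y (subisotropicRounding n m D δ y) :=
    fun y hy => isStep_subisotropicRounding D hδ0 hδ hy
  refine ⟨(RoundingAlgorithm.expectedIterations_le hx halg).trans
    (ENNReal.ofReal_le_ofReal (D.potential_le x)), ?_⟩
  obtain ⟨μ, hμ⟩ := RoundingAlgorithm.exists_hasOutput hx halg
  have hind : ∀ (I : Finset (Fin n)) i, 0 ≤ indVec I i ∧ indVec I i ≤ 1 := fun I i => by
    by_cases h : i ∈ I <;> simp [indVec, h]
  -- The limit argument gives only upper bounds, so it is applied to both y i and 1 - y i.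
  have hmean : ∀ i, expect μ (fun I => indVec I i) = x i := by
    intro i
    have h1 := RoundingAlgorithm.sum_output_mul_le hx halg hμ (g := fun y => y i)
      fun y hy => ((halg y hy).lexpect_coord i).1.le
    have h2 := RoundingAlgorithm.sum_output_mul_le hx halg hμ (g := fun y => 1 - y i)
      fun y hy => ((halg y hy).lexpect_coord i).2.le
    have h3 := expect_le_of_sum_le (fun I => (hind I i).1) (hx.1 i).1 h1
    have h4 := expect_le_of_sum_le (fun I => sub_nonneg.2 (hind I i).2)
      (sub_nonneg.2 (hx.1 i).2) h2
    have h5 : expect μ (fun I => 1 - indVec I i) = 1 - expect μ fun I => indVec I i := by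
      simp only [expect, mul_sub, mul_one, Finset.sum_sub_distrib, sum_toReal_apply]
    linarith
  refine ⟨μ, hμ, fun I hI => ⟨?_, fun j => ?_⟩, hmean, ?_, ?_⟩
  · exact DegMat.isBase_of_inBasePolytope (RoundingAlgorithm.of_mem_support_output
      (RoundingAlgorithm.inBasePolytope_of_mem_support_law hx halg) hμ hI)
  · refine DegMat.DegreeInvariant.lt (RoundingAlgorithm.of_mem_support_output
      (P := fun y => D.InBasePolytope y ∧ D.DegreeInvariant δ y j)
      (RoundingAlgorithm.forall_mem_support_law ⟨hx, Or.inl (hfeas.2 j)⟩ ?_) hμ hI).2 hδ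
    exact fun y hy y' hy' => ⟨((halg y hy.1).of_mem_support hy').1,
      (halg y hy.1).degreeInvariant hy.1 hy.2 hy'⟩
  · have h1 : (fun I : Finset (Fin n) => ∑ i ∈ I, D.cost i) =
        fun I => ∑ i, D.cost i * indVec I i := by
      ext I
      simp [indVec, Finset.sum_ite_mem]
    rw [h1, expect_sum_mul]
    simp only [hmean]
  · refine isConcentrated_of_expect_exp_le hδ0 (by linarith) hx.1 hmean
      fun a M lam hM hM0 hl hlM => ?_
    have h1 := RoundingAlgorithm.sum_output_mul_le hx halg hμ
      (g := fun y => Real.exp (lam * ∑ i, a i * y i +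
        6 / δ * lam ^ 2 * ∑ i, a i ^ 2 * (y i - y i ^ 2)))
      fun y hy => (halg y hy).lexpect_exp_le hy hδ0 (by linarith) hM hM0 hl hlM
    -- At the output the quadratic correction vanishes, leaving the pure exponential moment.
    have h2 : ∀ (I : Finset (Fin n)) i, indVec I i - indVec I i ^ 2 = 0 := fun I i => by
      by_cases h : i ∈ I <;> simp [indVec, h]
    simp only [h2, mul_zero, Finset.sum_const_zero, add_zero] at h1
    exact expect_le_of_sum_le (fun I => (Real.exp_pos _).le) (Real.exp_pos _).le h1

end
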